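/- Let $R$ and $C$ be finite sets with $|R|=m$ and $|C|=n$, let $w_R:R\to(0,\infty)$ and $w_C:C\to(0,\infty)$ be positive weight functions, and write $w_R(X)=\sum_{i\in X}w_R(i)$ for $X\subseteq R$ and $w_C(Y)=\sum_{j\in Y}w_C(j)$ for $Y\subseteq C$. Let $M=(M(i,j))_{i\in R,\,j\in C}$ be a random matrix whose entries are independent, with $M(i,j)$ exponentially distributed of rate $w_R(i)w_C(j)$, that is, $\Pr(M(i,j)>t)=e^{-w_R(i)w_C(j)t}$ for all $t\ge 0$. Let $k$ be an integer with $0\le k\le\min(m,n)$. A $k$-assignment is a set $\pi\subseteq R\times C$ of $k$ positions, no two in the same row or column, and $\min_k(M)$ denotes the minimum of $\sum_{(i,j)\in\pi}M(i,j)$ over all $k$-assignments $\pi$. Then $\min_k(M)$ is integrable and $$\mathbb{E}\bigl[\min\nolimits_k(M)\bigr]=\sum_{X\subseteq R,\;Y\subseteq C}\binom{m+n-1-|X|-|Y|}{k-1-|X|-|Y|}\,\frac{(-1)^{k-1-|X|-|Y|}}{w_R(R\setminus X)\,w_C(C\setminus Y)},$$ where a binomial coefficient with negative lower index is $0$; thus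 only terms with $|X|+|Y|<k$ contribute (for these both factors of the denominator are positive), and all other terms are read as $0$. -/

import Mathlib

open MeasureTheory ProbabilityTheory

namespace RandomAssignment

/-- A set of sites (matrix positions) is independent if no two distinct sites of it lie in the
same row or in the same column. -/
def IsIndependent {R C : Type*} (s : Finset (R × C)) : Prop :=
  ∀ p ∈ s, ∀ q ∈ s, p ≠ q → p.1 ≠ q.1 ∧ p.2 ≠ q.2

/-- A `k`-assignment is an independent set of exactly `k` sites. -/
def IsAssignment {R C : Type*} (k : ℕ) (s : Finset (R × C)) : Prop :=
  IsIndependent s ∧ s.card = k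

/-- The cost of a set of sites: the sum of the matrix entries in it. -/
def cost {R C : Type*} (M : R → C → ℝ) (s : Finset (R × C)) : ℝ :=
  ∑ p ∈ s, M p.1 p.2

/-- `minK k M` is the minimum cost of all `k`-assignments in `M`. For finite `R` and `C` and
`k ≤ min |R| |C|` the infimum is over a finite nonempty set, and is attained (`isLeast_minK`). -/
noncomputable def minK {R C : Type*} (k : ℕ) (M : R → C → ℝ) : ℝ :=
  sInf {c : ℝ | ∃ s : Finset (R × C), IsAssignment k s ∧ cost M s = c}

theorem exists_isAssignment {R C : Type*} [Fintype R] [Fintype C] {k : ℕ}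
    (hR : k ≤ Fintype.card R) (hC : k ≤ Fintype.card C) :
    ∃ s : Finset (R × C), IsAssignment k s := by
  obtain ⟨f⟩ : Nonempty (Fin k ↪ R) :=
    Function.Embedding.nonempty_of_card_le (by simpa using hR)
  obtain ⟨g⟩ : Nonempty (Fin k ↪ C) :=
    Function.Embedding.nonempty_of_card_le (by simpa using hC)
  refine ⟨Finset.univ.map
    ⟨fun i => (f i, g i), fun i j h => f.injective (Prod.ext_iff.mp h).1⟩, ?_, by simp⟩
  intro p hp q hq hpq
  simp only [Finset.mem_map, Finset.mem_univ, true_and, Function.Embedding.coeFn_mk] at hp hq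
  obtain ⟨i, rfl⟩ := hp
  obtain ⟨j, rfl⟩ := hq
  have hij : i ≠ j := fun h => hpq (by rw [h])
  exact ⟨fun h => hij (f.injective h), fun h => hij (g.injective h)⟩

theorem isLeast_minK {R C : Type*} [Fintype R] [Fintype C] {k : ℕ}
    (hR : k ≤ Fintype.card R) (hC : k ≤ Fintype.card C) (M : R → C → ℝ) :
    IsLeast {c : ℝ | ∃ s : Finset (R × C), IsAssignment k s ∧ cost M s = c} (minK k M) := by
  have hfin : {c : ℝ | ∃ s : Finset (R × C), IsAssignment k s ∧ cost M s = c}.Finite :=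
    (Set.toFinite {s : Finset (R × C) | IsAssignment k s}).image (cost M)
  obtain ⟨s, hs⟩ := exists_isAssignment hR hC
  have hne : {c : ℝ | ∃ s : Finset (R × C), IsAssignment k s ∧ cost M s = c}.Nonempty :=
    ⟨_, s, hs, rfl⟩
  exact ⟨hne.csInf_mem hfin, fun c hc => csInf_le hfin.bddBelow hc⟩

/-- The binomial coefficient of two integers, zero when the lower index is negative. -/
def binom (a b : ℤ) : ℤ :=
  if b < 0 then 0 else Ring.choose a b.toNat

end RandomAssignment

/-! Adjoin to the matrix an extra row of weight `q` and compute in two ways the probability that the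
optimal `(k + 1)`-assignment avoids it.

The first way determines the law of the row set of the optimal assignment. By alternating paths, the
rows of an optimal `k`-assignment survive in an optimal `(k + 1)`-assignment
(`IsOptimal.exists_insert_row`). That the rows `X` are extended through column `b` depends on two
entries of that column outside `X` only through their minimum (`LocallyExtendsAt.of_min_eq`), and
the smallest such entry decides the new row (`extendsAt_iff`). Competing exponentials
(`pi_expMeasure_swap`) therefore add a row with probability proportional to its weight. So the
optimal row set is distributed like the first clocks to ring among independent exponential clocks
with the row weights, whatever the columns are, and `soleTime` solves the recursion.

The second way conditions on the original matrix `M`. The extra row is avoided if and only if its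
entry in each column `j` is at least the gap between the `(k + 1)`-minimum of `M` and the
`k`-minimum of `M` without column `j`. This has probability `exp (-q H)`, where `H` is the
`wC`-weighted sum of the gaps. Comparing first-order terms as `q → 0` gives the expectation of `H`
(`integral_columnGap`), which is a recursion in `k` for the expected minimum (`integral_minK_succ`).
The closed formula satisfies the same recursion by Pascal's rule (`expectedMinFormula_succ`), and
both sides vanish at `k = 0`. -/

namespace RandomAssignment

/-! ### Alternating paths and exchange between assignments. -/

section Combinatorics

variable {R C : Type*} [DecidableEq R] [DecidableEq C]

/-- The set of rows met by a set of sites. -/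
def rows (s : Finset (R × C)) : Finset R := s.image Prod.fst

/-- Two sets of sites are separated if no site of one shares a row or a column with a site of the
other. -/
def Separated (s t : Finset (R × C)) : Prop :=
  ∀ p ∈ s, ∀ q ∈ t, p.1 ≠ q.1 ∧ p.2 ≠ q.2

/-- An assignment of minimal cost among all `k`-assignments. -/
def IsOptimal (k : ℕ) (M : R → C → ℝ) (s : Finset (R × C)) : Prop :=
  IsAssignment k s ∧ ∀ t, IsAssignment k t → cost M s ≤ cost M t

omit [DecidableEq C] in
theorem mem_rows {s : Finset (R × C)} {i : R} : i ∈ rows s ↔ ∃ j, (i, j) ∈ s := by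
  simp [rows]

omit [DecidableEq C] in
theorem fst_mem_rows {s : Finset (R × C)} {p : R × C} (hp : p ∈ s) : p.1 ∈ rows s :=
  Finset.mem_image_of_mem _ hp

omit [DecidableEq C] in
theorem rows_mono {s t : Finset (R × C)} (h : s ⊆ t) : rows s ⊆ rows t :=
  Finset.image_subset_image h

theorem rows_union (s t : Finset (R × C)) : rows (s ∪ t) = rows s ∪ rows t :=
  Finset.image_union _ _

omit [DecidableEq R] [DecidableEq C] in
theorem IsIndependent.mono {s t : Finset (R × C)} (ht : IsIndependent t) (h : s ⊆ t) :
    IsIndependent s :=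
  fun p hp q hq => ht p (h hp) q (h hq)

omit [DecidableEq R] [DecidableEq C] in
theorem IsIndependent.eq_of_fst {s : Finset (R × C)} (hs : IsIndependent s) {p q : R × C}
    (hp : p ∈ s) (hq : q ∈ s) (h : p.1 = q.1) : p = q := by
  by_contra hne
  exact (hs p hp q hq hne).1 h

omit [DecidableEq R] [DecidableEq C] in
theorem IsIndependent.eq_of_snd {s : Finset (R × C)} (hs : IsIndependent s) {p q : R × C}
    (hp : p ∈ s) (hq : q ∈ s) (h : p.2 = q.2) : p = q := by
  by_contra hne
  exact (hs p hp q hq hne).2 h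

omit [DecidableEq C] in
theorem IsIndependent.card_rows {s : Finset (R × C)} (hs : IsIndependent s) :
    (rows s).card = s.card :=
  Finset.card_image_of_injOn fun _ hp _ hq h => hs.eq_of_fst hp hq h

theorem IsIndependent.separated_sdiff {s s₁ : Finset (R × C)} (hs : IsIndependent s)
    (h : s₁ ⊆ s) : Separated s₁ (s \ s₁) := by
  intro p hp q hq
  rw [Finset.mem_sdiff] at hq
  exact hs p (h hp) q hq.1 fun e => hq.2 (e ▸ hp)

/-- Replacing a part `K` of an independent set by a separated independent set `L`. -/
theorem IsIndependent.replace {s K L : Finset (R × C)} (hs : IsIndependent s)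
    (hL : IsIndependent L) (hK : K ⊆ s) (hsep : Separated L (s \ K)) :
    IsIndependent (s \ K ∪ L) ∧ (s \ K ∪ L).card + K.card = s.card + L.card ∧
      (∀ M : R → C → ℝ, cost M (s \ K ∪ L) + cost M K = cost M s + cost M L) ∧
      (∀ i, i ∈ rows (s \ K ∪ L) ↔ (i ∈ rows s ∧ i ∉ rows K) ∨ i ∈ rows L) := by
  have hdisj : Disjoint (s \ K) L := by
    rw [Finset.disjoint_left]
    intro p hp hpL
    exact (hsep p hpL p hp).1 rfl
  refine ⟨?_, ?_, ?_, ?_⟩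
  · intro p hp q hq hpq
    rw [Finset.mem_union] at hp hq
    rcases hp with hp | hp <;> rcases hq with hq | hq
    · exact hs p (Finset.sdiff_subset hp) q (Finset.sdiff_subset hq) hpq
    · exact ⟨(hsep q hq p hp).1.symm, (hsep q hq p hp).2.symm⟩
    · exact hsep p hp q hq
    · exact hL p hp q hq hpq
  · rw [Finset.card_union_of_disjoint hdisj]
    have := Finset.card_sdiff_add_card_eq_card hK
    omega
  · intro M
    unfold cost
    rw [Finset.sum_union hdisj, ← Finset.sum_sdiff hK]
    ring
  · intro i
    rw [rows_union, Finset.mem_union]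
    refine or_congr_left ?_
    constructor
    · intro hi
      obtain ⟨j, hj⟩ := mem_rows.1 hi
      refine ⟨rows_mono Finset.sdiff_subset hi, fun hiK => ?_⟩
      obtain ⟨j', hj'⟩ := mem_rows.1 hiK
      exact (hs.separated_sdiff hK _ hj' _ hj).1 rfl
    · rintro ⟨hi, hiK⟩
      obtain ⟨j, hj⟩ := mem_rows.1 hi
      exact mem_rows.2 ⟨j, Finset.mem_sdiff.2 ⟨hj, fun h => hiK (mem_rows.2 ⟨j, h⟩)⟩⟩

/-- The alternating path that starts in a row met by `t` but not by `s`. -/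
theorem exists_alternating_path {s t : Finset (R × C)} (hs : IsIndependent s)
    (ht : IsIndependent t) {y : R} (hyt : y ∈ rows t) (hys : y ∉ rows s) :
    ∃ s₁ ⊆ s, ∃ t₁ ⊆ t, y ∈ rows t₁ ∧ Separated s₁ (t \ t₁) ∧ Separated t₁ (s \ s₁) ∧
      (rows t₁ = insert y (rows s₁) ∨
        ∃ x ∈ rows s₁, x ∉ rows t ∧ insert x (rows t₁) = insert y (rows s₁)) := by
  induction hn : t.card generalizing s t y with
  | zero =>
    rw [Finset.card_eq_zero] at hn
    simp [hn, rows] at hyt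
  | succ n ih =>
    obtain ⟨c, hc⟩ := mem_rows.1 hyt
    have hrows1 : rows {((y, c) : R × C)} = {y} := by simp [rows]
    -- The path leaves `y` along column `c`. It stops if `s` misses this column, or if the site of
    -- `s` there lies in a row `x` missed by `t`. Otherwise it continues from `x`: once both sites
    -- are erased, `x` is a row met by `t` and not by `s`.
    by_cases hcs : ∃ x, (x, c) ∈ s
    · obtain ⟨x, hx⟩ := hcs
      have hxy : x ≠ y := fun h => hys (mem_rows.2 ⟨c, h ▸ hx⟩)
      by_cases hxt : x ∈ rows t
      · have hx' : x ∈ rows (t.erase (y, c)) := by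
          obtain ⟨d, hd⟩ := mem_rows.1 hxt
          refine mem_rows.2 ⟨d, Finset.mem_erase.2 ⟨fun h => hxy (Prod.ext_iff.1 h).1, hd⟩⟩
        have hxs' : x ∉ rows (s.erase (x, c)) := by
          intro h
          obtain ⟨d, hd⟩ := mem_rows.1 h
          rw [Finset.mem_erase] at hd
          exact hd.1 (hs.eq_of_fst hd.2 hx rfl)
        obtain ⟨s₁, hs₁, t₁, ht₁, hxt₁, hsep₁, hsep₂, hor⟩ :=
          ih (hs.mono (Finset.erase_subset (x, c) s)) (ht.mono (Finset.erase_subset (y, c) t))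
            hx' hxs' (by rw [Finset.card_erase_of_mem hc, hn]; rfl)
        have hr1 : rows (insert (x, c) s₁) = insert x (rows s₁) := by simp [rows]
        have hr2 : rows (insert (y, c) t₁) = insert y (rows t₁) := by simp [rows]
        refine ⟨insert (x, c) s₁, ?_, insert (y, c) t₁, ?_, ?_, ?_, ?_, ?_⟩
        · exact Finset.insert_subset hx (hs₁.trans (Finset.erase_subset _ _))
        · exact Finset.insert_subset hc (ht₁.trans (Finset.erase_subset _ _))
        · rw [hr2]; exact Finset.mem_insert_self _ _
        · intro p hp q hq
          rw [Finset.mem_sdiff, Finset.mem_insert, not_or] at hq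
          rw [Finset.mem_insert] at hp
          rcases hp with rfl | hp
          · constructor
            · intro h
              obtain ⟨d, hd⟩ := mem_rows.1 hxt₁
              have := ht.eq_of_fst (ht₁.trans (Finset.erase_subset _ _) hd) hq.1 h
              exact hq.2.2 (this ▸ hd)
            · exact (ht _ hc _ hq.1 (Ne.symm hq.2.1)).2
          · exact hsep₁ p hp q (Finset.mem_sdiff.2 ⟨Finset.mem_erase.2 ⟨hq.2.1, hq.1⟩, hq.2.2⟩)
        · intro p hp q hq
          rw [Finset.mem_sdiff, Finset.mem_insert, not_or] at hq
          rw [Finset.mem_insert] at hp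
          rcases hp with rfl | hp
          · refine ⟨fun h => hys ((show y = q.1 from h) ▸ fst_mem_rows hq.1), ?_⟩
            exact (hs _ hx _ hq.1 (Ne.symm hq.2.1)).2
          · exact hsep₂ p hp q (Finset.mem_sdiff.2 ⟨Finset.mem_erase.2 ⟨hq.2.1, hq.1⟩, hq.2.2⟩)
        · rw [hr1, hr2]
          rcases hor with h | ⟨z, hz, hzt, h⟩
          · left; rw [h]
          · right
            refine ⟨z, Finset.mem_insert_of_mem hz, ?_, ?_⟩
            · intro hzt'
              obtain ⟨d, hd⟩ := mem_rows.1 hzt'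
              have : z ≠ y := by
                rintro rfl
                exact hys (rows_mono (hs₁.trans (Finset.erase_subset _ _)) hz)
              exact hzt (mem_rows.2 ⟨d, Finset.mem_erase.2
                ⟨fun e => this (Prod.ext_iff.1 e).1, hd⟩⟩)
            · rw [Finset.insert_comm, h]
      · refine ⟨{(x, c)}, by simpa using hx, {(y, c)}, by simpa using hc, by simp [rows],
          ?_, ?_, Or.inr ⟨x, by simp [rows], hxt, ?_⟩⟩
        · intro p hp q hq
          rw [Finset.mem_singleton] at hp
          rw [Finset.mem_sdiff, Finset.mem_singleton] at hq
          subst hp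
          exact ⟨fun h => hxt ((show x = q.1 from h) ▸ fst_mem_rows hq.1), (ht _ hc _ hq.1 (Ne.symm hq.2)).2⟩
        · intro p hp q hq
          rw [Finset.mem_singleton] at hp
          rw [Finset.mem_sdiff, Finset.mem_singleton] at hq
          subst hp
          exact ⟨fun h => hys ((show y = q.1 from h) ▸ fst_mem_rows hq.1), (hs _ hx _ hq.1 (Ne.symm hq.2)).2⟩
        · simp [rows, Finset.pair_comm]
    · refine ⟨∅, by simp, {(y, c)}, by simpa using hc, by simp [rows], ?_, ?_,
        Or.inl (by simp [rows])⟩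
      · intro p hp; simp at hp
      · intro p hp q hq
        rw [Finset.mem_singleton] at hp
        rw [Finset.mem_sdiff] at hq
        subst hp
        refine ⟨fun h => hys ((show y = q.1 from h) ▸ fst_mem_rows hq.1), fun h => hcs ⟨q.1, ?_⟩⟩
        have : (q.1, c) = q := Prod.ext rfl h
        rw [this]; exact hq.1

omit [DecidableEq C] in
theorem exists_mem_rows_notMem_rows {s t : Finset (R × C)} (hs : IsIndependent s)
    (ht : IsIndependent t) (h : s.card < t.card) : ∃ y ∈ rows t, y ∉ rows s := by
  rw [← hs.card_rows, ← ht.card_rows] at h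
  exact Finset.exists_mem_notMem_of_card_lt_card h

/-- Exchange for independent sets of equal size: a part `K` of `s` can be traded for an equally
large part `L` of `t` meeting exactly one row outside `s`. -/
theorem exists_exchange {s t : Finset (R × C)} (hs : IsIndependent s) (ht : IsIndependent t)
    (hcard : s.card = t.card) {y : R} (hyt : y ∈ rows t) (hys : y ∉ rows s) :
    ∃ K ⊆ s, ∃ L ⊆ t, Separated K (t \ L) ∧ Separated L (s \ K) ∧ K.card = L.card ∧
      ∃ r ∈ rows L, r ∉ rows s ∧ rows L ⊆ insert r (rows s) := by
  obtain ⟨s₁, hs₁, t₁, ht₁, hy, hsep₁, hsep₂, hor⟩ := exists_alternating_path hs ht hyt hys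
  have is₁ := hs.mono hs₁
  have it₁ := ht.mono ht₁
  -- A path ending in a row has equally many sites of both sets and can be traded as it is. A path
  -- ending in a column has one more site of `t`; then more is left of `s` than of `t`, and a second
  -- path is started from `s`.
  rcases hor with h | ⟨x, hx, hxt, h⟩
  · have hc1 : t₁.card = s₁.card + 1 := by
      rw [← it₁.card_rows, h, Finset.card_insert_of_notMem (fun h' => hys (rows_mono hs₁ h')),
        is₁.card_rows]
    have is₀ := hs.mono (Finset.sdiff_subset (s := s) (t := s₁))
    have it₀ := ht.mono (Finset.sdiff_subset (s := t) (t := t₁))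
    obtain ⟨x, hxs, hxt⟩ := exists_mem_rows_notMem_rows it₀ is₀ (by
      have := Finset.card_sdiff_add_card_eq_card hs₁
      have := Finset.card_sdiff_add_card_eq_card ht₁
      omega)
    obtain ⟨s₂, hs₂, t₂, ht₂, hx, hsep₃, hsep₄, hor⟩ := exists_alternating_path it₀ is₀ hxs hxt
    have is₂ := it₀.mono hs₂
    have it₂ := is₀.mono ht₂
    have ht₂s : t₂ ⊆ s := ht₂.trans Finset.sdiff_subset
    have hs₂t : s₂ ⊆ t := hs₂.trans Finset.sdiff_subset
    -- Two paths of opposite surplus are traded together, with new row `y`. If the second path ends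
    -- in a row `z`, it is balanced and is traded alone, with new row `z`.
    rcases hor with h' | ⟨z, hz, hzs, h'⟩
    · have hc2 : t₂.card = s₂.card + 1 := by
        rw [← it₂.card_rows, h', Finset.card_insert_of_notMem (fun h'' => hxt (rows_mono hs₂ h'')),
          is₂.card_rows]
      refine ⟨s₁ ∪ t₂, Finset.union_subset hs₁ ht₂s, t₁ ∪ s₂, Finset.union_subset ht₁ hs₂t,
        ?_, ?_, ?_, y, ?_, hys, ?_⟩
      · intro p hp q hq
        simp only [Finset.mem_union, Finset.mem_sdiff, not_or] at hp hq
        rcases hp with hp | hp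
        · exact hsep₁ p hp q (Finset.mem_sdiff.2 ⟨hq.1, hq.2.1⟩)
        · exact hsep₄ p hp q (by simp only [Finset.mem_sdiff]; tauto)
      · intro p hp q hq
        simp only [Finset.mem_union, Finset.mem_sdiff, not_or] at hp hq
        rcases hp with hp | hp
        · exact hsep₂ p hp q (Finset.mem_sdiff.2 ⟨hq.1, hq.2.1⟩)
        · exact hsep₃ p hp q (by simp only [Finset.mem_sdiff]; tauto)
      · rw [Finset.card_union_of_disjoint, Finset.card_union_of_disjoint]
        · omega
        · rw [Finset.disjoint_left]
          intro p hp hp'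
          exact (Finset.mem_sdiff.1 (hs₂ hp')).2 hp
        · rw [Finset.disjoint_left]
          intro p hp hp'
          exact (Finset.mem_sdiff.1 (ht₂ hp')).2 hp
      · rw [rows_union]; exact Finset.mem_union_left _ hy
      · rw [rows_union, h]
        refine Finset.union_subset (Finset.insert_subset_insert _ (rows_mono hs₁)) ?_
        refine Finset.Subset.trans ?_ (Finset.subset_insert _ _)
        refine Finset.Subset.trans ?_ (rows_mono ht₂s)
        rw [h']; exact Finset.subset_insert _ _
    · refine ⟨t₂, ht₂s, s₂, hs₂t, ?_, ?_, ?_, z, hz, ?_, ?_⟩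
      · intro p hp q hq
        rw [Finset.mem_sdiff] at hq
        by_cases hq1 : q ∈ t₁
        · have := hsep₂ q hq1 p (ht₂ hp)
          exact ⟨this.1.symm, this.2.symm⟩
        · exact hsep₄ p hp q (by simp only [Finset.mem_sdiff]; tauto)
      · intro p hp q hq
        rw [Finset.mem_sdiff] at hq
        by_cases hq1 : q ∈ s₁
        · have := hsep₁ q hq1 p (hs₂ hp)
          exact ⟨this.1.symm, this.2.symm⟩
        · exact hsep₃ p hp q (by simp only [Finset.mem_sdiff]; tauto)
      · have := congrArg Finset.card h'
        rw [Finset.card_insert_of_notMem (fun h'' => hzs (rows_mono ht₂ h'')),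
          Finset.card_insert_of_notMem (fun h'' => hxt (rows_mono hs₂ h'')),
          is₂.card_rows, it₂.card_rows] at this
        omega
      · intro hzs'
        obtain ⟨d, hd⟩ := mem_rows.1 hzs'
        by_cases hd1 : (z, d) ∈ s₁
        · obtain ⟨e, he⟩ := mem_rows.1 hz
          exact (hsep₁ _ hd1 _ (hs₂ he)).1 rfl
        · exact hzs (mem_rows.2 ⟨d, Finset.mem_sdiff.2 ⟨hd, hd1⟩⟩)
      · refine Finset.Subset.trans (Finset.subset_insert x _) ?_
        rw [← h']
        exact Finset.insert_subset_insert _ (rows_mono ht₂s)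
  · refine ⟨s₁, hs₁, t₁, ht₁, hsep₁, hsep₂, ?_, y, hy, hys, ?_⟩
    · have := congrArg Finset.card h
      rw [Finset.card_insert_of_notMem (fun h'' => hxt (rows_mono ht₁ h'')),
        Finset.card_insert_of_notMem (fun h'' => hys (rows_mono hs₁ h'')),
        is₁.card_rows, it₁.card_rows] at this
      omega
    · refine Finset.Subset.trans (Finset.subset_insert x _) ?_
      rw [h]
      exact Finset.insert_subset_insert _ (rows_mono hs₁)

/-- An assignment is optimal as soon as no assignment with at most one new row is cheaper. -/
theorem isOptimal_of_local {k : ℕ} {M : R → C → ℝ} {s : Finset (R × C)} (hs : IsAssignment k s)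
    (hloc : ∀ t, IsAssignment k t → (rows t \ rows s).card ≤ 1 → cost M s ≤ cost M t) :
    IsOptimal k M s := by
  refine ⟨hs, fun t ht => ?_⟩
  induction hn : (rows t \ rows s).card using Nat.strong_induction_on generalizing t with
  | _ n ih =>
    by_cases hle : (rows t \ rows s).card ≤ 1
    · exact hloc t ht hle
    obtain ⟨y, hy⟩ : (rows t \ rows s).Nonempty := by
      rw [← Finset.card_pos]; omega
    rw [Finset.mem_sdiff] at hy
    -- The trade preserves the sum of the two costs. It leaves `s` with at most one new row and `t`
    -- with fewer new rows than before; both results cost at least as much as `s`, hence so does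
    -- `t`.
    obtain ⟨K, hK, L, hL, hsep₁, hsep₂, hKL, r, hr, hrs, hsub⟩ :=
      exists_exchange hs.1 ht.1 (hs.2.trans ht.2.symm) hy.1 hy.2
    obtain ⟨i1, c1, cost1, rows1⟩ := hs.1.replace (ht.1.mono hL) hK hsep₂
    obtain ⟨i2, c2, cost2, rows2⟩ := ht.1.replace (hs.1.mono hK) hL hsep₁
    have h1 := hloc (s \ K ∪ L) ⟨i1, by have := hs.2; omega⟩ (by
      refine (Finset.card_le_card (t := {r}) ?_).trans (by simp)
      intro i hi
      rw [Finset.mem_sdiff, rows1] at hi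
      rcases hi with ⟨hi | hi, hi'⟩
      · exact absurd hi.1 hi'
      · have := hsub hi
        rw [Finset.mem_insert] at this
        simpa using this.resolve_right hi')
    have h2 := ih (rows (t \ L ∪ K) \ rows s).card (by
        rw [← hn]
        refine Finset.card_lt_card (Finset.ssubset_iff_of_subset ?_ |>.2 ⟨r, ?_, ?_⟩)
        · intro i hi
          rw [Finset.mem_sdiff, rows2] at hi
          rcases hi with ⟨hi | hi, hi'⟩
          · exact Finset.mem_sdiff.2 ⟨hi.1, hi'⟩
          · exact absurd (rows_mono hK hi) hi'
        · exact Finset.mem_sdiff.2 ⟨rows_mono hL hr, hrs⟩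
        · rw [Finset.mem_sdiff, rows2]
          rintro ⟨hi | hi, -⟩
          · exact hi.2 hr
          · exact hrs (rows_mono hK hi))
      (t \ L ∪ K) ⟨i2, by have := ht.2; omega⟩ rfl
    have := cost1 M
    have := cost2 M
    linarith

/-- The rows of an optimal `k`-assignment can be kept when passing to `k + 1`. -/
theorem IsOptimal.exists_insert_row {k : ℕ} {M : R → C → ℝ} {s t : Finset (R × C)}
    (hs : IsOptimal k M s) (ht : IsAssignment (k + 1) t) :
    ∃ t', IsAssignment (k + 1) t' ∧ (∃ y ∉ rows s, rows t' = insert y (rows s)) ∧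
      cost M t' ≤ cost M t := by
  induction hn : (rows t \ rows s).card using Nat.strong_induction_on generalizing t with
  | _ n ih =>
    obtain ⟨y, hyt, hys⟩ := exists_mem_rows_notMem_rows hs.1.1 ht.1 (by
      have := hs.1.2; have := ht.2; omega)
    obtain ⟨s₁, hs₁, t₁, ht₁, hy, hsep₁, hsep₂, hor⟩ :=
      exists_alternating_path hs.1.1 ht.1 hyt hys
    have is₁ := hs.1.1.mono hs₁
    have it₁ := ht.1.mono ht₁
    obtain ⟨i1, c1, cost1, rows1⟩ := hs.1.1.replace it₁ hs₁ hsep₂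
    obtain ⟨i2, c2, cost2, rows2⟩ := ht.1.replace is₁ ht₁ hsep₁
    have hcs := hs.1.2
    have hct := ht.2
    have e1 := cost1 M
    have e2 := cost2 M
    -- The swap preserves the sum of the two costs. If it enlarges `s`, it turns `t` into a
    -- `k`-assignment, no cheaper than `s`, so the enlarged set costs at most as much as `t`. If it
    -- keeps the sizes, it cannot cheapen `s`, so `t` gets no dearer while losing a row outside `s`.
    rcases hor with h | ⟨x, hx, hxt, h⟩
    · have hc1 : t₁.card = s₁.card + 1 := by
        rw [← it₁.card_rows, h, Finset.card_insert_of_notMem (fun h' => hys (rows_mono hs₁ h')),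
          is₁.card_rows]
      refine ⟨s \ s₁ ∪ t₁, ⟨i1, by omega⟩, ⟨y, hys, ?_⟩, ?_⟩
      · ext i
        rw [rows1, h, Finset.mem_insert, Finset.mem_insert]
        have := @rows_mono _ _ _ _ _ hs₁ i
        tauto
      · have := hs.2 (t \ t₁ ∪ s₁) ⟨i2, by omega⟩
        linarith
    · have hc : t₁.card = s₁.card := by
        have := congrArg Finset.card h
        rw [Finset.card_insert_of_notMem (fun h'' => hxt (rows_mono ht₁ h'')),
          Finset.card_insert_of_notMem (fun h'' => hys (rows_mono hs₁ h'')),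
          is₁.card_rows, it₁.card_rows] at this
        omega
      have h1 := hs.2 (s \ s₁ ∪ t₁) ⟨i1, by omega⟩
      obtain ⟨t', h2, h3, h4⟩ := ih (rows (t \ t₁ ∪ s₁) \ rows s).card (by
          rw [← hn]
          refine Finset.card_lt_card (Finset.ssubset_iff_of_subset ?_ |>.2 ⟨y, ?_, ?_⟩)
          · intro i hi
            rw [Finset.mem_sdiff, rows2] at hi
            rcases hi with ⟨hi | hi, hi'⟩
            · exact Finset.mem_sdiff.2 ⟨hi.1, hi'⟩
            · exact absurd (rows_mono hs₁ hi) hi'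
          · exact Finset.mem_sdiff.2 ⟨hyt, hys⟩
          · rw [Finset.mem_sdiff, rows2]
            rintro ⟨hi | hi, -⟩
            · exact hi.2 hy
            · exact hys (rows_mono hs₁ hi))
        (t := t \ t₁ ∪ s₁) ⟨i2, by omega⟩ rfl
      exact ⟨t', h2, h3, by linarith⟩

end Combinatorics

/-! ### Extending an optimal row set through a given column. -/

section Extension

variable {R C : Type*} [DecidableEq R] [DecidableEq C]

/-- The rows `X` carry an optimal `k`-assignment, and some optimal `(k + 1)`-assignment adds the
row `y` to them and uses the site `(y, b)`. -/
def ExtendsAt (k : ℕ) (X : Finset R) (y : R) (b : C) (M : R → C → ℝ) : Prop :=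
  ∃ s, IsOptimal k M s ∧ rows s = X ∧
    ∃ t, IsOptimal (k + 1) M t ∧ rows t = insert y X ∧ (y, b) ∈ t

/-- The variant of `ExtendsAt` in which the new row is unspecified and costs are compared only
with assignments that meet at most one row outside `X`. -/
def LocallyExtendsAt (k : ℕ) (X : Finset R) (b : C) (M : R → C → ℝ) : Prop :=
  (∃ s, IsAssignment k s ∧ rows s = X ∧
    ∀ t, IsAssignment k t → (rows t \ X).card ≤ 1 → cost M s ≤ cost M t) ∧
  ∃ y ∉ X, ∃ t, IsAssignment (k + 1) t ∧ rows t = insert y X ∧ (y, b) ∈ t ∧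
    ∀ u, IsAssignment (k + 1) u → (rows u \ X).card ≤ 1 → cost M t ≤ cost M u

/-- Moving the only site outside the rows `X` within its column. -/
theorem IsIndependent.move_site {t : Finset (R × C)} (ht : IsIndependent t) {X : Finset R}
    {l l' : R} {b : C} (hlb : (l, b) ∈ t) (hl : l ∉ X) (hsub : rows t ⊆ insert l X)
    (hl' : l' ∉ X) :
    ∃ t', IsIndependent t' ∧ t'.card = t.card ∧ (l', b) ∈ t' ∧ rows t' ⊆ insert l' X ∧
      (rows t = insert l X → rows t' = insert l' X) ∧
      ∀ M : R → C → ℝ, cost M t' + M l b = cost M t + M l' b := by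
  have hrow : ∀ i, i ∈ rows ({(l, b)} : Finset (R × C)) ↔ i = l := by simp [rows]
  have hrow' : ∀ i, i ∈ rows ({(l', b)} : Finset (R × C)) ↔ i = l' := by simp [rows]
  obtain ⟨h1, h2, h3, h4⟩ := ht.replace (K := {(l, b)}) (L := {(l', b)})
    (by intro p hp q hq; simp_all) (by simpa using hlb) (by
      intro p hp q hq
      rw [Finset.mem_singleton] at hp
      rw [Finset.mem_sdiff, Finset.mem_singleton] at hq
      subst hp
      have := ht _ hlb _ hq.1 (Ne.symm hq.2)
      refine ⟨?_, this.2⟩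
      rintro h
      have h' := hsub (fst_mem_rows hq.1)
      rw [Finset.mem_insert] at h'
      rcases h' with h' | h'
      · exact this.1 h'.symm
      · exact hl' ((show l' = q.1 from h) ▸ h'))
  refine ⟨_, h1, by simpa using h2, by simp, ?_, ?_, fun M => by simpa [cost] using h3 M⟩
  · intro i hi
    rw [h4, hrow, hrow'] at hi
    rw [Finset.mem_insert]
    rcases hi with ⟨hi, hil⟩ | hi
    · exact Or.inr ((Finset.mem_insert.1 (hsub hi)).resolve_left hil)
    · exact Or.inl hi
  · intro h
    ext i
    rw [h4, h, hrow, hrow', Finset.mem_insert, Finset.mem_insert]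
    constructor
    · tauto
    · rintro (hi | hi)
      · exact Or.inr hi
      · exact Or.inl ⟨Or.inr hi, fun e => hl (e ▸ hi)⟩

omit [DecidableEq R] [DecidableEq C] in
theorem cost_congr {M M' : R → C → ℝ} {s : Finset (R × C)}
    (h : ∀ p ∈ s, M p.1 p.2 = M' p.1 p.2) : cost M s = cost M' s :=
  Finset.sum_congr rfl h

omit [DecidableEq C] in
theorem rows_subset_insert_of_card_le_one {u : Finset (R × C)} {X : Finset R} {l : R}
    (hu : (rows u \ X).card ≤ 1) (hl : l ∈ rows u) (hlX : l ∉ X) : rows u ⊆ insert l X := by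
  intro i hi
  rw [Finset.mem_insert]
  by_contra hcon
  push Not at hcon
  exact hcon.1 (Finset.card_le_one.1 hu i (Finset.mem_sdiff.2 ⟨hi, hcon.2⟩) l
    (Finset.mem_sdiff.2 ⟨hl, hlX⟩))

/-- An independent set has at most one site in column `b`. If this is one of the two changed
entries, it is moved to a row among `a`, `a'` where `M` is small enough; otherwise the costs agree.
The move cannot collide because no other row outside `X` is met, which is why the local notion
compares only such sets. -/
theorem IsIndependent.exists_cost_le_of_min_eq {M M' : R → C → ℝ} {X : Finset R} {a a' : R}
    {b : C} (ha : a ∉ X) (ha' : a' ∉ X)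
    (hoff : ∀ i j, (i, j) ≠ (a, b) → (i, j) ≠ (a', b) → M i j = M' i j)
    (hmin : min (M a b) (M a' b) = min (M' a b) (M' a' b))
    {u : Finset (R × C)} (hu : IsIndependent u) (hcard : (rows u \ X).card ≤ 1) :
    ∃ u', IsIndependent u' ∧ u'.card = u.card ∧ (rows u' \ X).card ≤ 1 ∧
      cost M u' ≤ cost M' u ∧
      ∀ l ∉ X, (l, b) ∈ u → rows u = insert l X →
        ∃ l' ∉ X, (l', b) ∈ u' ∧ rows u' = insert l' X := by
  by_cases hmem : ∃ l, (l = a ∨ l = a') ∧ (l, b) ∈ u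
  · obtain ⟨l, hl, hlu⟩ := hmem
    have hlX : l ∉ X := by rcases hl with rfl | rfl <;> assumption
    obtain ⟨c, hcX, hc⟩ : ∃ c ∉ X, M c b ≤ M' l b ∧ (c = a ∨ c = a') := by
      have : min (M a b) (M a' b) ≤ M' l b := by
        rw [hmin]; rcases hl with rfl | rfl
        · exact min_le_left _ _
        · exact min_le_right _ _
      rcases min_le_iff.1 this with h | h
      · exact ⟨a, ha, h, Or.inl rfl⟩
      · exact ⟨a', ha', h, Or.inr rfl⟩
    obtain ⟨u', h1, h2, h3, h4, h5, h6⟩ := hu.move_site hlu hlX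
      (rows_subset_insert_of_card_le_one hcard (fst_mem_rows hlu) hlX) hcX
    refine ⟨u', h1, h2, ?_, ?_, fun l₁ _ hl₁u hrow => ⟨c, hcX, h3, h5 ?_⟩⟩
    · refine (Finset.card_le_card (t := {c}) fun i hi => ?_).trans (by simp)
      rw [Finset.mem_sdiff] at hi
      simpa using (Finset.mem_insert.1 (h4 hi.1)).resolve_right hi.2
    · have e := h6 M
      have : cost M u + M' l b = cost M' u + M l b := by
        unfold cost
        rw [← Finset.add_sum_erase _ _ hlu, ← Finset.add_sum_erase u (fun p => M' p.1 p.2) hlu]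
        have : ∑ p ∈ u.erase (l, b), M p.1 p.2 = ∑ p ∈ u.erase (l, b), M' p.1 p.2 := by
          refine Finset.sum_congr rfl fun p hp => ?_
          rw [Finset.mem_erase] at hp
          have hne : p.2 ≠ b := (hu _ hp.2 _ hlu hp.1).2
          exact hoff _ _ (fun e => hne (Prod.ext_iff.1 e).2) (fun e => hne (Prod.ext_iff.1 e).2)
        rw [this]; ring
      linarith [hc.1]
    · have := hu.eq_of_snd hl₁u hlu rfl
      rw [hrow, (Prod.mk.inj this).1]
  · push Not at hmem
    refine ⟨u, hu, rfl, hcard, (cost_congr fun p hp => hoff _ _ ?_ ?_).le,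
      fun l hl hlu hrow => ⟨l, hl, hlu, hrow⟩⟩
    · intro e; exact hmem a (Or.inl rfl) (e ▸ hp)
    · intro e; exact hmem a' (Or.inr rfl) (e ▸ hp)

/-- Local extension depends on two entries of column `b` only through their minimum. -/
theorem LocallyExtendsAt.of_min_eq {k : ℕ} {M M' : R → C → ℝ} {X : Finset R} {a a' : R}
    {b : C} (ha : a ∉ X) (ha' : a' ∉ X)
    (hoff : ∀ i j, (i, j) ≠ (a, b) → (i, j) ≠ (a', b) → M i j = M' i j)
    (hmin : min (M a b) (M a' b) = min (M' a b) (M' a' b))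
    (h : LocallyExtendsAt k X b M) : LocallyExtendsAt k X b M' := by
  obtain ⟨⟨s, hs, hsX, hloc⟩, y, hy, t, ht, htX, hyb, htloc⟩ := h
  refine ⟨⟨s, hs, hsX, fun u hu hcard => ?_⟩, ?_⟩
  · obtain ⟨u', h1, h2, h3, h4, -⟩ := hu.1.exists_cost_le_of_min_eq ha ha' hoff hmin hcard
    -- All rows of `s` lie in `X`, so `s` contains neither of the two entries.
    have e : cost M s = cost M' s := by
      refine cost_congr fun p hp => hoff _ _ ?_ ?_
      · intro e; exact ha ((Prod.mk.inj e).1 ▸ hsX ▸ fst_mem_rows hp)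
      · intro e; exact ha' ((Prod.mk.inj e).1 ▸ hsX ▸ fst_mem_rows hp)
    rw [← e]
    exact (hloc u' ⟨h1, h2.trans hu.2⟩ h3).trans h4
  · obtain ⟨t', h1, h2, h3, h4, h5⟩ := ht.1.exists_cost_le_of_min_eq ha ha'
      (fun i j h h' => (hoff i j h h').symm) hmin.symm (u := t) (X := X) (by
        rw [htX]
        refine (Finset.card_le_card (t := {y}) fun i hi => ?_).trans (by simp)
        rw [Finset.mem_sdiff] at hi
        simpa using (Finset.mem_insert.1 hi.1).resolve_right hi.2)
    obtain ⟨y', hy', hyb', hrow⟩ := h5 y hy hyb htX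
    refine ⟨y', hy', t', ⟨h1, h2.trans ht.2⟩, hrow, hyb', fun u hu hcard => ?_⟩
    obtain ⟨u', g1, g2, g3, g4, -⟩ := hu.1.exists_cost_le_of_min_eq ha ha' hoff hmin hcard
    exact h4.trans ((htloc u' ⟨g1, g2.trans hu.2⟩ g3).trans g4)

/-- Extension by the site `(y, b)` means local extension through column `b`, with the smallest
entry of that column outside `X` in row `y`. -/
theorem extendsAt_iff {k : ℕ} {M : R → C → ℝ} {X : Finset R} {y : R} {b : C} (hy : y ∉ X) :
    ExtendsAt k X y b M ↔ LocallyExtendsAt k X b M ∧ ∀ l ∉ X, M y b ≤ M l b := by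
  constructor
  · rintro ⟨s, hs, hsX, t, ht, htX, hyb⟩
    refine ⟨⟨⟨s, hs.1, hsX, fun u hu _ => hs.2 u hu⟩, y, hy, t, ht.1, htX, hyb,
      fun u hu _ => ht.2 u hu⟩, fun l hl => ?_⟩
    obtain ⟨t', h1, h2, -, -, -, h6⟩ := ht.1.1.move_site hyb hy htX.subset hl
    have := ht.2 t' ⟨h1, h2.trans ht.1.2⟩
    linarith [h6 M]
  · rintro ⟨⟨⟨s, hs, hsX, hloc⟩, y₀, hy₀, t, ht, htX, hyb, htloc⟩, hmin⟩
    have hsopt : IsOptimal k M s := isOptimal_of_local hs fun u hu hcard =>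
      hloc u hu (hsX ▸ hcard)
    obtain ⟨t', h1, h2, h3, -, h5, h6⟩ := ht.1.move_site hyb hy₀ htX.subset hy
    refine ⟨s, hsopt, hsX, t', ⟨⟨h1, h2.trans ht.2⟩, fun u hu => ?_⟩, h5 htX, h3⟩
    -- An arbitrary competitor gives way to one that is no dearer and meets a single row outside
    -- `X`, where local minimality applies.
    obtain ⟨u', g1, ⟨z, hz, g2⟩, g3⟩ := hsopt.exists_insert_row hu
    have := htloc u' g1 (by
      rw [g2, hsX]
      refine (Finset.card_le_card (t := {z}) fun i hi => ?_).trans (by simp)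
      rw [Finset.mem_sdiff] at hi
      simpa using (Finset.mem_insert.1 hi.1).resolve_right hi.2)
    linarith [h6 M, hmin y₀ hy₀]

end Extension

/-! ### The exponential distribution. -/

section Exponential

theorem expMeasure_eq_withDensity (r : ℝ) :
    expMeasure r = volume.withDensity (exponentialPDF r) := rfl

theorem measurable_exponentialPDF (r : ℝ) : Measurable (exponentialPDF r) :=
  (measurable_exponentialPDFReal r).ennreal_ofReal

instance nullSingletonClass_expMeasure (r : ℝ) : NullSingletonClass (expMeasure r) := by
  rw [expMeasure_eq_withDensity]; infer_instance

theorem expMeasure_Ici {r : ℝ} (hr : 0 < r) {x : ℝ} (hx : 0 ≤ x) :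
    expMeasure r (Set.Ici x) = ENNReal.ofReal (Real.exp (-(r * x))) := by
  have := isProbabilityMeasure_expMeasure hr
  have h1 : expMeasure r (Set.Ici x) = expMeasure r (Set.Ioi x) :=
    (measure_congr Ioi_ae_eq_Ici).symm
  have h2 : (expMeasure r).real (Set.Iic x) = 1 - Real.exp (-(r * x)) := by
    rw [← cdf_eq_real, cdf_expMeasure_eq hr, if_pos hx]
  have h3 : (expMeasure r).real (Set.Ioi x) = Real.exp (-(r * x)) := by
    rw [← Set.compl_Iic, probReal_compl_eq_one_sub measurableSet_Iic, h2]; ring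
  rw [h1, ← h3, ofReal_measureReal]

theorem expMeasure_Iio_zero (r : ℝ) : expMeasure r (Set.Iio 0) = 0 := by
  rw [expMeasure_eq_withDensity, withDensity_apply _ measurableSet_Iio]
  exact lintegral_exponentialPDF_of_nonpos le_rfl

theorem integrable_id_expMeasure {r : ℝ} (hr : 0 < r) :
    Integrable (fun x : ℝ => x) (expMeasure r) := by
  have h := integrableOn_rpow_mul_exp_neg_mul_rpow (s := 1) (p := 1) (b := r) (by norm_num)
    one_pos hr
  have h' : Integrable (fun x : ℝ => (exponentialPDF r x).toReal * x) volume := by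
    rw [← integrable_indicator_iff measurableSet_Ioi] at h
    refine (h.const_mul r).congr (Filter.Eventually.of_forall fun x => ?_)
    simp only [Set.indicator, Set.mem_Ioi]
    by_cases hx : 0 < x
    · rw [if_pos hx, exponentialPDF_of_nonneg hx.le, ENNReal.toReal_ofReal (by positivity)]
      simp only [Real.rpow_one]
      rw [neg_mul]; ring
    · rw [if_neg hx]
      rcases (not_lt.1 hx).lt_or_eq with hx | hx
      · simp [exponentialPDF_of_neg hx]
      · simp [hx]
  rw [expMeasure_eq_withDensity]
  refine (integrable_withDensity_iff (measurable_exponentialPDF r) ?_).2 ?_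
  · exact Filter.Eventually.of_forall fun x => ENNReal.ofReal_lt_top
  · simpa only [mul_comm] using h'

/-- On `u ≥ 0` both sides integrate `g u * r * s * exp (-(r + s) * u)`, which is symmetric in the
rates. -/
theorem lintegral_mul_expMeasure_Ici_comm {r s : ℝ} (hr : 0 < r) (hs : 0 < s)
    {g : ℝ → ENNReal} (hg : Measurable g) :
    ENNReal.ofReal s * ∫⁻ u, g u * expMeasure s (Set.Ici u) ∂(expMeasure r) =
      ENNReal.ofReal r * ∫⁻ u, g u * expMeasure r (Set.Ici u) ∂(expMeasure s) := by
  have hm : ∀ q : ℝ, Measurable fun u : ℝ => expMeasure q (Set.Ici u) := fun q =>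
    Antitone.measurable fun u v huv => measure_mono (Set.Ici_subset_Ici.2 huv)
  have hd : ∀ q : ℝ, ∀ f : ℝ → ENNReal, Measurable f →
      ∫⁻ u, f u ∂(expMeasure q) = ∫⁻ u, exponentialPDF q u * f u := fun q f hf =>
    lintegral_withDensity_eq_lintegral_mul _ (measurable_exponentialPDF q) hf
  rw [hd r (fun u => g u * _) (hg.mul (hm s)), hd s (fun u => g u * _) (hg.mul (hm r)),
    ← lintegral_const_mul' _ _ ENNReal.ofReal_ne_top, ← lintegral_const_mul' _ _ ENNReal.ofReal_ne_top]
  refine lintegral_congr fun u => ?_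
  rcases lt_or_ge u 0 with hu | hu
  · simp [exponentialPDF_of_neg hu]
  · rw [exponentialPDF_of_nonneg hu, exponentialPDF_of_nonneg hu, expMeasure_Ici hs hu,
      expMeasure_Ici hr hu, ENNReal.ofReal_mul hr.le, ENNReal.ofReal_mul hs.le]
    ring

end Exponential

/-! ### Competition and null sets in product measures. -/

section Product

variable {ι : Type*} [Fintype ι] [DecidableEq ι]

/-- Competition of two independent exponential variables: which of the two is the smaller one is
independent of every event that involves them only through their minimum. -/
theorem pi_expMeasure_swap {r : ι → ℝ} (hr : ∀ i, 0 < r i) {a b : ι} (hab : a ≠ b)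
    {G : Set (ι → ℝ)} (hG : MeasurableSet G)
    (hmin : ∀ x y : ι → ℝ, (∀ i, i ≠ a → i ≠ b → x i = y i) →
      min (x a) (x b) = min (y a) (y b) → x ∈ G → y ∈ G) :
    ENNReal.ofReal (r b) * Measure.pi (fun i => expMeasure (r i)) (G ∩ {x | x a ≤ x b}) =
      ENNReal.ofReal (r a) * Measure.pi (fun i => expMeasure (r i)) (G ∩ {x | x b ≤ x a}) := by
  have : ∀ i, IsProbabilityMeasure (expMeasure (r i)) := fun i =>
    isProbabilityMeasure_expMeasure (hr i)
  -- With `x c = u` the smaller entry, the value of `x d ≥ u` does not affect the minimum.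
  -- Membership in `G` can thus be tested with both entries equal to `u`, and integrating over `x d`
  -- leaves only its tail.
  have key : ∀ c d : ι, c ≠ d → (∀ x y : ι → ℝ, (∀ i, i ≠ c → i ≠ d → x i = y i) →
      min (x c) (x d) = min (y c) (y d) → x ∈ G → y ∈ G) → ∀ x : ι → ℝ,
      (∫⋯∫⁻_{c, d}, (G ∩ {x | x c ≤ x d}).indicator 1 ∂(fun i => expMeasure (r i))) x =
        ∫⁻ u, G.indicator 1 (Function.update (Function.update x c u) d u) *
          expMeasure (r d) (Set.Ici u) ∂(expMeasure (r c)) := by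
    intro c d hcd hmin x
    have hS : MeasurableSet (G ∩ {x : ι → ℝ | x c ≤ x d}) :=
      hG.inter (measurableSet_le (measurable_pi_apply c) (measurable_pi_apply d))
    rw [lmarginal_insert _ (measurable_one.indicator hS) (by simpa using hcd)]
    refine lintegral_congr fun u => ?_
    rw [lmarginal_singleton]
    rw [← lintegral_indicator_one measurableSet_Ici, ← lintegral_const_mul _
      (measurable_one.indicator measurableSet_Ici)]
    refine lintegral_congr fun v => ?_
    have e1 : Function.update (Function.update x c u) d v c = u := by
      rw [Function.update_of_ne hcd, Function.update_self]
    have e2 : Function.update (Function.update x c u) d v d = v := Function.update_self ..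
    have f1 : Function.update (Function.update x c u) d u c = u := by
      rw [Function.update_of_ne hcd, Function.update_self]
    have f2 : Function.update (Function.update x c u) d u d = u := Function.update_self ..
    by_cases huv : u ≤ v
    · have hiff : Function.update (Function.update x c u) d v ∈ G ↔
          Function.update (Function.update x c u) d u ∈ G := by
        constructor
        · refine hmin _ _ (fun i hi hi' => ?_) ?_
          · simp [Function.update_of_ne hi']
          · rw [e1, e2, f1, f2, min_eq_left huv, min_self]
        · refine hmin _ _ (fun i hi hi' => ?_) ?_
          · simp [Function.update_of_ne hi']
          · rw [e1, e2, f1, f2, min_eq_left huv, min_self]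
      have hiff' : Function.update (Function.update x c u) d v ∈ G ∩ {x | x c ≤ x d} ↔
          Function.update (Function.update x c u) d u ∈ G := by
        rw [Set.mem_inter_iff, hiff, Set.mem_ofPred_eq, e1, e2]
        exact and_iff_left huv
      have hv : v ∈ Set.Ici u := huv
      simp only [Set.indicator, hv, if_true, Pi.one_apply, mul_one]
      by_cases hG' : Function.update (Function.update x c u) d u ∈ G
      · rw [if_pos hG', if_pos (hiff'.2 hG')]
      · rw [if_neg hG', if_neg (mt hiff'.1 hG')]
    · have hnot : Function.update (Function.update x c u) d v ∉ G ∩ {x | x c ≤ x d} := by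
        rintro ⟨-, h⟩
        rw [Set.mem_ofPred_eq, e1, e2] at h
        exact huv h
      have hv : v ∉ Set.Ici u := huv
      simp only [Set.indicator, hnot, hv, if_false, mul_zero]
  have hmeas : ∀ c d : ι, MeasurableSet (G ∩ {x : ι → ℝ | x c ≤ x d}) := fun c d =>
    hG.inter (measurableSet_le (measurable_pi_apply c) (measurable_pi_apply d))
  rw [← lintegral_indicator_one (hmeas a b), ← lintegral_indicator_one (hmeas b a),
    ← lintegral_const_mul _ (measurable_one.indicator (hmeas a b)),
    ← lintegral_const_mul _ (measurable_one.indicator (hmeas b a))]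
  refine lintegral_eq_of_lmarginal_eq {a, b}
    ((measurable_one.indicator (hmeas a b)).const_mul _)
    ((measurable_one.indicator (hmeas b a)).const_mul _) ?_
  have hconst : ∀ (q : ENNReal) (f : (ι → ℝ) → ENNReal) (x : ι → ℝ), q ≠ ⊤ →
      (∫⋯∫⁻_{a, b}, (fun x => q * f x) ∂(fun i => expMeasure (r i))) x =
        q * (∫⋯∫⁻_{a, b}, f ∂(fun i => expMeasure (r i))) x := by
    intro q f x hq
    exact lintegral_const_mul' _ _ hq
  funext x
  rw [hconst _ _ _ ENNReal.ofReal_ne_top, hconst _ _ _ ENNReal.ofReal_ne_top, key a b hab hmin,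
    Finset.pair_comm, key b a hab.symm (fun x y h h' => hmin x y (fun i hi hi' => h i hi' hi)
      (by rw [min_comm, h', min_comm]))]
  have hcomm : ∀ u : ℝ, Function.update (Function.update x b u) a u =
      Function.update (Function.update x a u) b u := fun u => Function.update_comm hab.symm u u x
  simp only [hcomm]
  refine lintegral_mul_expMeasure_Ici_comm (hr a) (hr b)
    ((measurable_one.indicator hG).comp ?_)
  refine measurable_pi_iff.2 fun i => ?_
  by_cases hib : i = b
  · subst hib; simpa using measurable_id'
  · by_cases hia : i = a
    · subst hia; simpa [Function.update_of_ne hib] using measurable_id'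
    · simp [Function.update_of_ne hib, Function.update_of_ne hia]

/-- Fubini in the coordinate `e`: every slice has at most one point, and `μ e` has no atoms. -/
theorem pi_eq_zero_of_subsingleton {μ : ι → Measure ℝ} [∀ i, SigmaFinite (μ i)] (e : ι)
    [NullSingletonClass (μ e)] {S : Set (ι → ℝ)} (hS : MeasurableSet S)
    (h : ∀ x, {u | Function.update x e u ∈ S}.Subsingleton) : Measure.pi μ S = 0 := by
  rw [← lintegral_indicator_one hS, ← lintegral_zero (μ := Measure.pi μ)]
  refine lintegral_eq_of_lmarginal_eq {e} (measurable_one.indicator hS) measurable_const ?_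
  funext x
  rw [lmarginal_singleton, lmarginal_singleton, lintegral_zero]
  have h1 : (fun u => S.indicator (1 : (ι → ℝ) → ENNReal) (Function.update x e u)) =
      {u | Function.update x e u ∈ S}.indicator 1 := rfl
  have hm : MeasurableSet {u | Function.update x e u ∈ S} := (measurable_update x) hS
  change ∫⁻ u, (fun u => S.indicator (1 : (ι → ℝ) → ENNReal) (Function.update x e u)) u ∂μ e = 0
  rw [h1, lintegral_indicator_one hm]
  exact (h x).measure_zero _

end Product

/-! ### The random row set of an optimal assignment. -/

section OptimalRows

variable {R C : Type*}

/-- The rows `X` carry an optimal `k`-assignment. -/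
def IsOptimalRows [DecidableEq R] (k : ℕ) (X : Finset R) (M : R → C → ℝ) : Prop :=
  ∃ s, IsOptimal k M s ∧ rows s = X

/-- A matrix is generic if no two sets of sites have the same cost. -/
def IsGeneric (M : R → C → ℝ) : Prop :=
  ∀ s t : Finset (R × C), cost M s = cost M t → s = t

/-- The law of a matrix of independent exponential variables of rates `wR i * wC j`. -/
noncomputable def matrixMeasure [Fintype R] [Fintype C] (wR : R → ℝ) (wC : C → ℝ) :
    Measure (R × C → ℝ) :=
  Measure.pi fun p => expMeasure (wR p.1 * wC p.2)

theorem isProbabilityMeasure_matrixMeasure [Fintype R] [Fintype C] {wR : R → ℝ} {wC : C → ℝ}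
    (hwR : ∀ i, 0 < wR i) (hwC : ∀ j, 0 < wC j) :
    IsProbabilityMeasure (matrixMeasure wR wC) := by
  have : ∀ p : R × C, IsProbabilityMeasure (expMeasure (wR p.1 * wC p.2)) := fun p =>
    isProbabilityMeasure_expMeasure (mul_pos (hwR _) (hwC _))
  unfold matrixMeasure
  infer_instance

theorem IsGeneric.isOptimal_unique {M : R → C → ℝ} (hM : IsGeneric M) {k : ℕ}
    {s t : Finset (R × C)} (hs : IsOptimal k M s) (ht : IsOptimal k M t) : s = t :=
  hM s t (le_antisymm (hs.2 t ht.1) (ht.2 s hs.1))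

theorem exists_isOptimal [Fintype R] [Fintype C] {k : ℕ} (hR : k ≤ Fintype.card R)
    (hC : k ≤ Fintype.card C) (M : R → C → ℝ) : ∃ s, IsOptimal k M s ∧ cost M s = minK k M := by
  obtain ⟨⟨s, hs, hc⟩, hle⟩ := isLeast_minK hR hC M
  exact ⟨s, ⟨hs, fun t ht => hc ▸ hle ⟨t, ht, rfl⟩⟩, hc⟩

theorem measurable_cost (s : Finset (R × C)) :
    Measurable fun f : R × C → ℝ => cost (Function.curry f) s := by
  unfold cost Function.curry
  exact Finset.measurable_sum _ fun p _ => measurable_pi_apply _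

theorem measurable_isOptimal [Fintype R] [Fintype C] (k : ℕ) (s : Finset (R × C)) :
    Measurable fun f : R × C → ℝ => IsOptimal k (Function.curry f) s := by
  unfold IsOptimal
  refine measurable_const.and (Measurable.forall fun t => measurable_const.imp ?_)
  exact measurableSet_setOfPred.1 (measurableSet_le (measurable_cost s) (measurable_cost t))

theorem measurableSet_isOptimalRows [Fintype R] [Fintype C] [DecidableEq R] (k : ℕ)
    (X : Finset R) : MeasurableSet {f : R × C → ℝ | IsOptimalRows k X (Function.curry f)} := by
  refine measurableSet_setOfPred.2 (Measurable.exists fun s => ?_)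
  exact (measurable_isOptimal k s).and measurable_const

theorem measurableSet_extendsAt [Fintype R] [Fintype C] [DecidableEq R] (k : ℕ)
    (X : Finset R) (y : R) (b : C) :
    MeasurableSet {f : R × C → ℝ | ExtendsAt k X y b (Function.curry f)} := by
  refine measurableSet_setOfPred.2 (Measurable.exists fun s => ?_)
  refine (measurable_isOptimal k s).and (measurable_const.and (Measurable.exists fun t => ?_))
  exact (measurable_isOptimal (k + 1) t).and (measurable_const.and measurable_const)

theorem measurableSet_locallyExtendsAt [Fintype R] [Fintype C] [DecidableEq R] (k : ℕ)
    (X : Finset R) (b : C) :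
    MeasurableSet {f : R × C → ℝ | LocallyExtendsAt k X b (Function.curry f)} := by
  have hle : ∀ s t : Finset (R × C), Measurable fun f : R × C → ℝ =>
      cost (Function.curry f) s ≤ cost (Function.curry f) t := fun s t =>
    measurableSet_setOfPred.1 (measurableSet_le (measurable_cost s) (measurable_cost t))
  refine measurableSet_setOfPred.2 (Measurable.and (Measurable.exists fun s => ?_)
    (Measurable.exists fun y => ?_))
  · exact measurable_const.and (measurable_const.and (Measurable.forall fun t =>
      measurable_const.imp (measurable_const.imp (hle s t))))
  · exact measurable_const.and (Measurable.exists fun t => measurable_const.and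
      (measurable_const.and (measurable_const.and (Measurable.forall fun u =>
        measurable_const.imp (measurable_const.imp (hle t u))))))

/-- Additivity up to null sets is what is needed: optimal assignments are unique only for generic
matrices. -/
theorem measureReal_eq_sum_of_ae {Ω ι : Type*} [MeasurableSpace Ω] {μ : Measure Ω}
    [IsFiniteMeasure μ] {I : Finset ι} {E : Set Ω} {A : ι → Set Ω}
    (hA : ∀ i ∈ I, MeasurableSet (A i)) (hE : ∀ᵐ ω ∂μ, ω ∈ E ↔ ∃ i ∈ I, ω ∈ A i)
    (hdisj : ∀ᵐ ω ∂μ, ∀ i ∈ I, ∀ j ∈ I, ω ∈ A i → ω ∈ A j → i = j) :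
    μ.real E = ∑ i ∈ I, μ.real (A i) := by
  have h1 : μ E = μ (⋃ i ∈ I, A i) := by
    refine measure_congr (Filter.eventuallyEq_set.2 ?_)
    filter_upwards [hE] with ω hω
    simpa using hω
  have h2 : μ (⋃ i ∈ I, A i) = ∑ i ∈ I, μ (A i) := by
    refine measure_biUnion_finset₀ (fun i hi j hj hij => ?_)
      fun i hi => (hA i hi).nullMeasurableSet
    refine measure_mono_null (t := {ω | ¬ ∀ i ∈ I, ∀ j ∈ I, ω ∈ A i → ω ∈ A j → i = j}) ?_ hdisj
    rintro ω ⟨hi', hj'⟩ hcon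
    exact hij (hcon i hi j hj hi' hj')
  rw [measureReal_def, h1, h2, ENNReal.toReal_sum fun _ _ => measure_ne_top _ _]
  rfl

variable [Fintype R] [Fintype C] [DecidableEq R] [DecidableEq C] {wR : R → ℝ} {wC : C → ℝ}

/-- If two different sets have equal costs, an entry at a site of exactly one of them is determined
by the other entries. -/
theorem ae_isGeneric (hwR : ∀ i, 0 < wR i) (hwC : ∀ j, 0 < wC j) :
    ∀ᵐ f ∂(matrixMeasure wR wC), IsGeneric (Function.curry f) := by
  have : ∀ p : R × C, IsProbabilityMeasure (expMeasure (wR p.1 * wC p.2)) := fun p =>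
    isProbabilityMeasure_expMeasure (mul_pos (hwR _) (hwC _))
  have key : ∀ s t : Finset (R × C), ∀ e ∈ s, e ∉ t → matrixMeasure wR wC
      {f | cost (Function.curry f) s = cost (Function.curry f) t} = 0 := by
    intro s t e hes het
    refine pi_eq_zero_of_subsingleton e
      (measurableSet_eq_fun (measurable_cost s) (measurable_cost t)) fun x u hu v hv => ?_
    rw [Set.mem_ofPred_eq, Set.mem_ofPred_eq] at hu hv
    have h1 : ∀ z : ℝ, cost (Function.curry (Function.update x e z)) s =
        z + ∑ p ∈ s.erase e, x p := by
      intro z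
      unfold cost Function.curry
      rw [← Finset.add_sum_erase _ _ hes]
      simp only [Prod.mk.eta, Function.update_self, add_right_inj]
      exact Finset.sum_congr rfl fun p hp =>
        Function.update_of_ne (Finset.mem_erase.1 hp).1 _ _
    have h2 : ∀ z : ℝ, cost (Function.curry (Function.update x e z)) t = ∑ p ∈ t, x p := by
      intro z
      unfold cost Function.curry
      simp only [Prod.mk.eta]
      exact Finset.sum_congr rfl fun p hp =>
        Function.update_of_ne (fun h : p = e => het (h ▸ hp)) _ _
    rw [h1, h2] at hu hv
    linarith
  have key' : ∀ s t : Finset (R × C), ∀ᵐ f ∂(matrixMeasure wR wC),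
      cost (Function.curry f) s = cost (Function.curry f) t → s = t := by
    intro s t
    by_cases hst : s = t
    · exact Filter.Eventually.of_forall fun _ _ => hst
    · have h0 : matrixMeasure wR wC
          {f | cost (Function.curry f) s = cost (Function.curry f) t} = 0 := by
        by_cases hsub : s ⊆ t
        · obtain ⟨e, het, hes⟩ := Finset.exists_of_ssubset (hsub.ssubset_of_ne hst)
          simpa only [eq_comm] using key t s e het hes
        · obtain ⟨e, hes, het⟩ := Finset.not_subset.1 hsub
          exact key s t e hes het
      filter_upwards [measure_eq_zero_iff_ae_notMem.1 h0] with f hf h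
      exact absurd h hf
  unfold IsGeneric
  rw [ae_all_iff]
  intro s
  rw [ae_all_iff]
  exact key' s

/-- Restrict to local extension through column `b` with the smallest entry outside `X` attained in
row `y` or `y'`. This event sees the two entries only through their minimum, and their competition
decides which row is added. The factor `wC b` of both rates cancels. -/
theorem matrixMeasure_extendsAt_swap (hwR : ∀ i, 0 < wR i) (hwC : ∀ j, 0 < wC j) (k : ℕ)
    {X : Finset R} {y y' : R} (hy : y ∉ X) (hy' : y' ∉ X) (b : C) :
    wR y' * (matrixMeasure wR wC).real {f | ExtendsAt k X y b (Function.curry f)} =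
      wR y * (matrixMeasure wR wC).real {f | ExtendsAt k X y' b (Function.curry f)} := by
  by_cases hne : y = y'
  · rw [hne]
  let G : Set (R × C → ℝ) := {f | LocallyExtendsAt k X b (Function.curry f)} ∩
    {f | ∀ l ∉ X, min (f (y, b)) (f (y', b)) ≤ f (l, b)}
  have hG : MeasurableSet G := by
    refine (measurableSet_locallyExtendsAt k X b).inter (measurableSet_setOfPred.2 ?_)
    refine Measurable.forall fun l => measurable_const.imp (measurableSet_setOfPred.1 ?_)
    exact measurableSet_le ((measurable_pi_apply (y, b)).min (measurable_pi_apply (y', b)))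
      (measurable_pi_apply (l, b))
  have hab : (y, b) ≠ (y', b) := fun h => hne (Prod.mk.inj h).1
  have h := pi_expMeasure_swap (r := fun p : R × C => wR p.1 * wC p.2)
    (fun p => mul_pos (hwR _) (hwC _)) hab hG (by
      rintro f g hoff hmin ⟨h1, h2⟩
      refine ⟨LocallyExtendsAt.of_min_eq hy hy' (fun i j h h' => hoff (i, j) h h') hmin h1,
        fun l hl => ?_⟩
      rw [← hmin]
      by_cases hly : l = y
      · rw [hmin, hly]; exact min_le_left _ _
      by_cases hly' : l = y'
      · rw [hmin, hly']; exact min_le_right _ _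
      rw [← hoff (l, b) (fun h => hly (Prod.mk.inj h).1) (fun h => hly' (Prod.mk.inj h).1)]
      exact h2 l hl)
  have e1 : G ∩ {f | f (y, b) ≤ f (y', b)} = {f | ExtendsAt k X y b (Function.curry f)} := by
    ext f
    rw [Set.mem_ofPred_eq, extendsAt_iff hy]
    constructor
    · rintro ⟨⟨h1, h2⟩, h3⟩
      refine ⟨h1, fun l hl => ?_⟩
      have := h2 l hl
      rwa [min_eq_left h3] at this
    · rintro ⟨h1, h2⟩
      exact ⟨⟨h1, fun l hl => (min_le_left _ _).trans (h2 l hl)⟩, h2 y' hy'⟩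
  have e2 : G ∩ {f | f (y', b) ≤ f (y, b)} = {f | ExtendsAt k X y' b (Function.curry f)} := by
    ext f
    rw [Set.mem_ofPred_eq, extendsAt_iff hy']
    constructor
    · rintro ⟨⟨h1, h2⟩, h3⟩
      refine ⟨h1, fun l hl => ?_⟩
      have := h2 l hl
      rwa [min_eq_right h3] at this
    · rintro ⟨h1, h2⟩
      exact ⟨⟨h1, fun l hl => (min_le_right _ _).trans (h2 l hl)⟩, h2 y hy⟩
  rw [e1, e2] at h
  have h' := congrArg ENNReal.toReal h
  rw [ENNReal.toReal_mul, ENNReal.toReal_mul,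
    ENNReal.toReal_ofReal (mul_pos (hwR _) (hwC _)).le,
    ENNReal.toReal_ofReal (mul_pos (hwR _) (hwC _)).le] at h'
  refine mul_left_cancel₀ (hwC b).ne' ?_
  calc _ = wR y' * wC b * (matrixMeasure wR wC
        {f | ExtendsAt k X y b (Function.curry f)}).toReal := by rw [measureReal_def]; ring
    _ = _ := h'.trans (by rw [measureReal_def, matrixMeasure]; ring)

/-- For a generic matrix the optimal `(k + 1)`-assignment is unique, so the added row and its column
are determined. -/
theorem matrixMeasure_isOptimalRows_eq_sum (hwR : ∀ i, 0 < wR i) (hwC : ∀ j, 0 < wC j) {k : ℕ}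
    (hR : k + 1 ≤ Fintype.card R) (hC : k + 1 ≤ Fintype.card C) (X : Finset R) :
    (matrixMeasure wR wC).real {f | IsOptimalRows k X (Function.curry f)} =
      ∑ y ∈ Xᶜ, ∑ b, (matrixMeasure wR wC).real {f | ExtendsAt k X y b (Function.curry f)} := by
  have := isProbabilityMeasure_matrixMeasure hwR hwC
  rw [← Finset.sum_product']
  refine measureReal_eq_sum_of_ae (fun p _ => measurableSet_extendsAt k X p.1 p.2) ?_ ?_
  · filter_upwards [ae_isGeneric hwR hwC] with f hf
    constructor
    · rintro ⟨s, hs, hsX⟩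
      obtain ⟨t, ht, -⟩ := exists_isOptimal hR hC (Function.curry f)
      obtain ⟨t', h1, ⟨y, hy, h2⟩, h3⟩ := hs.exists_insert_row ht.1
      rw [hsX] at hy h2
      obtain ⟨b, hb⟩ := mem_rows.1 (h2 ▸ Finset.mem_insert_self y X)
      exact ⟨(y, b), by simpa using hy, s, hs, hsX, t',
        ⟨h1, fun u hu => h3.trans (ht.2 u hu)⟩, h2, hb⟩
    · rintro ⟨p, -, s, hs, hsX, -⟩
      exact ⟨s, hs, hsX⟩
  · filter_upwards [ae_isGeneric hwR hwC] with f hf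
    rintro ⟨y, b⟩ hy ⟨y', b'⟩ hy' ⟨s, hs, hsX, t, ht, htX, hyb⟩ ⟨s', hs', hsX', t', ht', htX', hyb'⟩
    obtain rfl := hf.isOptimal_unique ht ht'
    simp only [Finset.mem_product, Finset.mem_compl, Finset.mem_univ, and_true] at hy hy'
    have : y = y' := by
      have h : y ∈ insert y' X := htX' ▸ htX ▸ Finset.mem_insert_self y X
      exact (Finset.mem_insert.1 h).resolve_right hy
    exact ht.1.1.eq_of_fst hyb hyb' this

/-- The same events, sorted by the larger row set. The row to be removed is determined because the
optimal `k`-assignment is unique as well. -/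
theorem matrixMeasure_isOptimalRows_succ_eq_sum (hwR : ∀ i, 0 < wR i) (hwC : ∀ j, 0 < wC j)
    {k : ℕ} (hR : k + 1 ≤ Fintype.card R) (hC : k + 1 ≤ Fintype.card C) (Y : Finset R) :
    (matrixMeasure wR wC).real {f | IsOptimalRows (k + 1) Y (Function.curry f)} =
      ∑ y ∈ Y, ∑ b,
        (matrixMeasure wR wC).real {f | ExtendsAt k (Y.erase y) y b (Function.curry f)} := by
  have := isProbabilityMeasure_matrixMeasure hwR hwC
  rw [← Finset.sum_product']
  refine measureReal_eq_sum_of_ae (fun p _ => measurableSet_extendsAt k _ p.1 p.2) ?_ ?_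
  · filter_upwards [ae_isGeneric hwR hwC] with f hf
    constructor
    · rintro ⟨t, ht, htY⟩
      obtain ⟨s, hs, -⟩ := exists_isOptimal (Nat.le_of_succ_le hR) (Nat.le_of_succ_le hC)
        (Function.curry f)
      obtain ⟨t', h1, ⟨y, hy, h2⟩, h3⟩ := hs.exists_insert_row ht.1
      obtain rfl := hf.isOptimal_unique ht ⟨h1, fun u hu => h3.trans (ht.2 u hu)⟩
      rw [htY] at h2
      obtain ⟨b, hb⟩ := mem_rows.1 (htY.symm ▸ h2 ▸ Finset.mem_insert_self y (rows s))
      have hYe : Y.erase y = rows s := by rw [h2, Finset.erase_insert hy]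
      refine ⟨(y, b), by simp [h2], s, hs, hYe.symm, t, ht, ?_, hb⟩
      rw [htY, hYe, h2]
    · rintro ⟨p, hp, s, hs, hsX, t, ht, htX, -⟩
      rw [Finset.mem_product] at hp
      exact ⟨t, ht, by rw [htX, Finset.insert_erase hp.1]⟩
  · filter_upwards [ae_isGeneric hwR hwC] with f hf
    rintro ⟨y, b⟩ hy ⟨y', b'⟩ hy' ⟨s, hs, hsX, t, ht, htX, hyb⟩ ⟨s', hs', hsX', t', ht', htX', hyb'⟩
    obtain rfl := hf.isOptimal_unique ht ht'
    obtain rfl := hf.isOptimal_unique hs hs'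
    simp only [Finset.mem_product, Finset.mem_univ, and_true] at hy hy'
    exact ht.1.1.eq_of_fst hyb hyb' (Finset.erase_injOn Y hy hy' (hsX.symm.trans hsX'))

/-- The row added last is chosen with probability proportional to its weight among the remaining
rows. -/
theorem matrixMeasure_isOptimalRows_succ (hwR : ∀ i, 0 < wR i) (hwC : ∀ j, 0 < wC j)
    {k : ℕ} (hR : k + 1 ≤ Fintype.card R) (hC : k + 1 ≤ Fintype.card C) (Y : Finset R) :
    (matrixMeasure wR wC).real {f | IsOptimalRows (k + 1) Y (Function.curry f)} =
      ∑ y ∈ Y, wR y *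
        (matrixMeasure wR wC).real {f | IsOptimalRows k (Y.erase y) (Function.curry f)} /
          ∑ i ∈ (Y.erase y)ᶜ, wR i := by
  rw [matrixMeasure_isOptimalRows_succ_eq_sum hwR hwC hR hC]
  refine Finset.sum_congr rfl fun y hy => ?_
  have hyX : y ∈ (Y.erase y)ᶜ := by simp
  have hpos : 0 < ∑ i ∈ (Y.erase y)ᶜ, wR i := Finset.sum_pos (fun i _ => hwR i) ⟨y, hyX⟩
  -- With the denominator cleared, the claim splits over the rows `i` outside `Y.erase y` and the
  -- columns; each term compares extension by `y` with extension by `i`.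
  rw [eq_div_iff hpos.ne', matrixMeasure_isOptimalRows_eq_sum hwR hwC hR hC, Finset.mul_sum,
    Finset.mul_sum]
  refine Finset.sum_congr rfl fun i hi => ?_
  rw [Finset.sum_mul, Finset.mul_sum]
  refine Finset.sum_congr rfl fun b _ => ?_
  rw [mul_comm]
  exact matrixMeasure_extendsAt_swap hwR hwC k (Finset.notMem_erase y Y)
    (Finset.mem_compl.1 hi) b

end OptimalRows

/-! ### Exponential clocks and the law of the optimal row set. -/

section SoleTime

variable {R : Type*} [Fintype R] [DecidableEq R]

/-- For independent exponential clocks with rates `w` and a further clock with rate `q`, the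
expected length of the time during which exactly the clocks in `Z` have rung. -/
noncomputable def soleTime (w : R → ℝ) (q : ℝ) (Z : Finset R) : ℝ :=
  ∑ V ∈ Z.powerset, (-1) ^ (Z.card + V.card) / (q + ∑ i ∈ Vᶜ, w i)

/-- Balance of flow: the expected number of departures from the state `Z` equals that of arrivals
from the states `Z.erase z`. Algebraically, the terms of each `V` on the two sides combine to cancel
its denominator, and the alternating sum over subsets of a nonempty set vanishes. -/
theorem soleTime_recursion {w : R → ℝ} (hw : ∀ i, 0 ≤ w i) {q : ℝ} {Z : Finset R}
    (hZ : Z.Nonempty) (hpos : 0 < q + ∑ i ∈ Zᶜ, w i) :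
    (q + ∑ i ∈ Zᶜ, w i) * soleTime w q Z = ∑ z ∈ Z, w z * soleTime w q (Z.erase z) := by
  unfold soleTime
  have h0 : ∑ V ∈ Z.powerset, (-1 : ℝ) ^ (Z.card + V.card) = 0 := by
    have h := Finset.sum_powerset_neg_one_pow_card_of_nonempty hZ
    have h' : ∑ V ∈ Z.powerset, (-1 : ℝ) ^ V.card = 0 := by exact_mod_cast h
    simp only [pow_add, ← Finset.mul_sum, h', mul_zero]
  have h1 : ∑ z ∈ Z, w z * ∑ V ∈ (Z.erase z).powerset,
      (-1) ^ ((Z.erase z).card + V.card) / (q + ∑ i ∈ Vᶜ, w i) =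
      ∑ V ∈ Z.powerset, ∑ z ∈ Z \ V,
        w z * ((-1) ^ (Z.card + V.card + 1) / (q + ∑ i ∈ Vᶜ, w i)) := by
    simp only [Finset.mul_sum]
    rw [Finset.sum_comm' (t' := Z.powerset) (s' := fun V => Z \ V)]
    · refine Finset.sum_congr rfl fun V _ => Finset.sum_congr rfl fun z hz => ?_
      have hc := Finset.card_erase_add_one (Finset.mem_sdiff.1 hz).1
      have e : Z.card + V.card + 1 = (Z.erase z).card + V.card + 2 := by omega
      rw [e, pow_add _ _ 2]
      norm_num
    · intro z V
      simp only [Finset.mem_powerset, Finset.mem_sdiff, Finset.subset_erase]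
      tauto
  rw [h1, Finset.mul_sum, ← sub_eq_zero, ← Finset.sum_sub_distrib, ← h0]
  refine Finset.sum_congr rfl fun V hV => ?_
  rw [Finset.mem_powerset] at hV
  have hsum : ∑ i ∈ Vᶜ, w i = ∑ z ∈ Z \ V, w z + ∑ i ∈ Zᶜ, w i := by
    rw [← Finset.sum_union]
    · congr 1
      ext i
      have := @hV i
      simp only [Finset.mem_compl, Finset.mem_union, Finset.mem_sdiff]
      tauto
    · rw [Finset.disjoint_left]
      intro i hi hi'
      exact Finset.mem_compl.1 hi' (Finset.mem_sdiff.1 hi).1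
  have hnn : 0 ≤ ∑ z ∈ Z \ V, w z := Finset.sum_nonneg fun i _ => hw i
  have hne : q + ∑ i ∈ Vᶜ, w i ≠ 0 := by rw [hsum]; linarith
  rw [← Finset.sum_mul, pow_succ]
  field_simp
  rw [hsum]
  ring

/-- Total flow from level `k` to level `k + 1`, indexed by a state together with the clock that
rings. -/
theorem sum_powersetCard_soleTime_succ {w : R → ℝ} (hw : ∀ i, 0 ≤ w i) {q : ℝ} (hq : 0 < q)
    (k : ℕ) :
    ∑ Z ∈ Finset.univ.powersetCard (k + 1), (q + ∑ i ∈ Zᶜ, w i) * soleTime w q Z =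
      ∑ Z ∈ Finset.univ.powersetCard k, (∑ i ∈ Zᶜ, w i) * soleTime w q Z := by
  have h1 : ∀ Z ∈ (Finset.univ : Finset R).powersetCard (k + 1),
      (q + ∑ i ∈ Zᶜ, w i) * soleTime w q Z = ∑ z ∈ Z, w z * soleTime w q (Z.erase z) := by
    intro Z hZ
    have hc := (Finset.mem_powersetCard.1 hZ).2
    refine soleTime_recursion hw (Finset.card_pos.1 (by omega)) ?_
    exact add_pos_of_pos_of_nonneg hq (Finset.sum_nonneg fun i _ => hw i)
  rw [Finset.sum_congr rfl h1]
  simp only [Finset.sum_mul]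
  rw [Finset.sum_sigma', Finset.sum_sigma']
  refine Finset.sum_bij' (fun x _ => ⟨x.1.erase x.2, x.2⟩) (fun x _ => ⟨insert x.2 x.1, x.2⟩)
    ?_ ?_ ?_ ?_ ?_
  · rintro ⟨Z, z⟩ h
    simp only [Finset.mem_sigma, Finset.mem_powersetCard, Finset.subset_univ, true_and] at h ⊢
    simp only [Finset.mem_compl, Finset.mem_erase, not_and_or, not_not]
    exact ⟨by rw [Finset.card_erase_of_mem h.2]; omega, by simp⟩
  · rintro ⟨Z, z⟩ h
    simp only [Finset.mem_sigma, Finset.mem_powersetCard, Finset.subset_univ, true_and,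
      Finset.mem_compl] at h ⊢
    exact ⟨by rw [Finset.card_insert_of_notMem h.2]; omega, by simp⟩
  · rintro ⟨Z, z⟩ h
    simp only [Finset.mem_sigma] at h
    simp [Finset.insert_erase h.2]
  · rintro ⟨Z, z⟩ h
    simp only [Finset.mem_sigma, Finset.mem_compl] at h
    simp [Finset.erase_insert h.2]
  · rintro ⟨Z, z⟩ h
    rfl

/-- The left side is the probability that `k` ordinary clocks ring before the extra one. At each
level the extra clock takes away `q` times the expected time spent there. -/
theorem sum_powersetCard_soleTime {w : R → ℝ} (hw : ∀ i, 0 ≤ w i) {q : ℝ} (hq : 0 < q) (k : ℕ) :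
    ∑ Z ∈ Finset.univ.powersetCard k, (q + ∑ i ∈ Zᶜ, w i) * soleTime w q Z =
      1 - q * ∑ l ∈ Finset.range k, ∑ Z ∈ Finset.univ.powersetCard l, soleTime w q Z := by
  induction k with
  | zero =>
    have : q + ∑ i, w i ≠ 0 :=
      (add_pos_of_pos_of_nonneg hq (Finset.sum_nonneg fun i _ => hw i)).ne'
    simp [soleTime, this]
  | succ k ih =>
    rw [sum_powersetCard_soleTime_succ hw hq, Finset.sum_range_succ]
    simp only [add_mul, Finset.sum_add_distrib, ← Finset.mul_sum] at ih
    linarith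

/-- A set of old rows never contains `none`, so the weight of the extra row occurs in every
denominator and acts as `q`. -/
theorem soleTime_map_some (w : R → ℝ) (q : ℝ) (Z : Finset R) :
    soleTime (fun o : Option R => o.elim q w) 0 (Z.map Function.Embedding.some) =
      soleTime w q Z := by
  unfold soleTime
  symm
  refine Finset.sum_bij (fun V _ => V.map Function.Embedding.some) ?_ ?_ ?_ ?_
  · intro V hV
    rw [Finset.mem_powerset] at hV ⊢
    exact Finset.map_subset_map.2 hV
  · intro V _ V' _ h
    exact Finset.map_injective _ h
  · intro V hV
    rw [Finset.mem_powerset, Finset.subset_map_iff] at hV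
    obtain ⟨V', h1, h2⟩ := hV
    exact ⟨V', Finset.mem_powerset.2 h1, h2.symm⟩
  · intro V _
    rw [Finset.card_map, Finset.card_map, zero_add]
    congr 1
    have : (V.map Function.Embedding.some)ᶜ = insert none (Vᶜ.map Function.Embedding.some) := by
      ext o
      cases o <;> simp
    rw [this, Finset.sum_insert (by simp), Finset.sum_map]
    rfl

theorem sum_compl_map_some (w : R → ℝ) (q : ℝ) (Z : Finset R) :
    ∑ o ∈ (Z.map Function.Embedding.some)ᶜ, (fun o : Option R => o.elim q w) o =
      q + ∑ i ∈ Zᶜ, w i := by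
  have : (Z.map Function.Embedding.some)ᶜ = insert none (Zᶜ.map Function.Embedding.some) := by
    ext o
    cases o <;> simp
  rw [this, Finset.sum_insert (by simp), Finset.sum_map]
  rfl

variable {C : Type*} [Fintype C] [DecidableEq C]

/-- The law of the set of rows of the optimal `k`-assignment. -/
theorem matrixMeasure_isOptimalRows {wR : R → ℝ} {wC : C → ℝ} (hwR : ∀ i, 0 < wR i)
    (hwC : ∀ j, 0 < wC j) {k : ℕ} (hR : k ≤ Fintype.card R) (hC : k ≤ Fintype.card C)
    {Z : Finset R} (hZ : Z.card = k) (hZu : Z ≠ Finset.univ) :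
    (matrixMeasure wR wC).real {f | IsOptimalRows k Z (Function.curry f)} =
      (∑ i ∈ Zᶜ, wR i) * soleTime wR 0 Z := by
  have hprob := isProbabilityMeasure_matrixMeasure hwR hwC
  have hpos : ∀ Z : Finset R, Z ≠ Finset.univ → 0 < ∑ i ∈ Zᶜ, wR i := fun Z hZ =>
    Finset.sum_pos (fun i _ => hwR i) (by rwa [Finset.nonempty_iff_ne_empty, Ne,
      Finset.compl_eq_empty_iff])
  induction k generalizing Z with
  | zero =>
    rw [Finset.card_eq_zero] at hZ
    subst hZ
    have h1 : {f : R × C → ℝ | IsOptimalRows 0 ∅ (Function.curry f)} = Set.univ := by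
      refine Set.eq_univ_of_forall fun f => ⟨∅, ⟨⟨fun p hp => by simp at hp, rfl⟩, ?_⟩, rfl⟩
      intro t ht
      rw [Finset.card_eq_zero.1 ht.2]
    have := (hpos ∅ hZu).ne'
    rw [h1, probReal_univ]
    simp only [soleTime, Finset.powerset_empty, Finset.sum_singleton, zero_add,
      Finset.card_empty, pow_zero]
    field_simp
  | succ k ih =>
    have hZ' : Z.Nonempty := Finset.card_pos.1 (by omega)
    -- At `q = 0` the balance of flow is the recursion for the row sets.
    have h := soleTime_recursion (q := 0) (fun i => (hwR i).le) hZ'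
      (by rw [zero_add]; exact hpos Z hZu)
    rw [zero_add] at h
    rw [matrixMeasure_isOptimalRows_succ hwR hwC hR hC, h]
    refine Finset.sum_congr rfl fun z hz => ?_
    have hne : Z.erase z ≠ Finset.univ := fun e => Finset.notMem_erase z Z (e ▸ Finset.mem_univ z)
    rw [ih (Nat.le_of_succ_le hR) (Nat.le_of_succ_le hC)
      (by rw [Finset.card_erase_of_mem hz, hZ]; rfl) hne]
    have := (hpos _ hne).ne'
    field_simp

/-- The probability that an extra row of weight `q` is not used by the optimal `k`-assignment. -/
theorem matrixMeasure_option_isOptimalRows {wR : R → ℝ} {wC : C → ℝ} (hwR : ∀ i, 0 < wR i)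
    (hwC : ∀ j, 0 < wC j) {q : ℝ} (hq : 0 < q) {k : ℕ} (hR : k ≤ Fintype.card R)
    (hC : k ≤ Fintype.card C) :
    (matrixMeasure (fun o : Option R => o.elim q wR) wC).real
        {f | ∃ Z : Finset R, IsOptimalRows k (Z.map Function.Embedding.some) (Function.curry f)} =
      1 - q * ∑ l ∈ Finset.range k, ∑ Z ∈ Finset.univ.powersetCard l, soleTime wR q Z := by
  have hw : ∀ o : Option R, 0 < (fun o : Option R => o.elim q wR) o := by
    rintro (_ | i)
    · exact hq
    · exact hwR i
  have hprob := isProbabilityMeasure_matrixMeasure hw hwC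
  rw [← sum_powersetCard_soleTime (fun i => (hwR i).le) hq,
    measureReal_eq_sum_of_ae (I := Finset.univ.powersetCard k) (A := fun Z : Finset R =>
      {f | IsOptimalRows k (Z.map Function.Embedding.some) (Function.curry f)})
      (fun Z _ => measurableSet_isOptimalRows k _) ?_ ?_]
  · refine Finset.sum_congr rfl fun Z hZ => ?_
    rw [matrixMeasure_isOptimalRows hw hwC (hR.trans (by simp)) hC
      (by rw [Finset.card_map, (Finset.mem_powersetCard.1 hZ).2]), soleTime_map_some,
      sum_compl_map_some]
    intro h
    have := h ▸ Finset.mem_univ (none : Option R)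
    simp at this
  · refine Filter.Eventually.of_forall fun f => ?_
    constructor
    · rintro ⟨Z, s, hs, hsZ⟩
      refine ⟨Z, Finset.mem_powersetCard.2 ⟨Finset.subset_univ _, ?_⟩, s, hs, hsZ⟩
      have := hs.1.1.card_rows
      rw [hsZ, Finset.card_map] at this
      rw [this, hs.1.2]
    · rintro ⟨Z, -, h⟩
      exact ⟨Z, h⟩
  · filter_upwards [ae_isGeneric hw hwC] with f hf
    rintro Z - Z' - ⟨s, hs, hsZ⟩ ⟨s', hs', hsZ'⟩
    rw [hf.isOptimal_unique hs hs', hsZ'] at hsZ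
    exact (Finset.map_injective _ hsZ).symm

end SoleTime

/-! ### Assignments after adding a row or deleting a column. -/

section Transport

variable {R C R' C' : Type*}

theorem IsAssignment.map {k : ℕ} {s : Finset (R × C)} (hs : IsAssignment k s) (f : R ↪ R')
    (g : C ↪ C') : IsAssignment k (s.map (f.prodMap g)) := by
  refine ⟨?_, by rw [Finset.card_map, hs.2]⟩
  intro p hp q hq hpq
  obtain ⟨p, hp', rfl⟩ := Finset.mem_map.1 hp
  obtain ⟨q, hq', rfl⟩ := Finset.mem_map.1 hq
  have h := hs.1 p hp' q hq' fun e => hpq (e ▸ rfl)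
  exact ⟨fun e => h.1 (f.injective e), fun e => h.2 (g.injective e)⟩

theorem cost_map (M : R' → C' → ℝ) (s : Finset (R × C)) (f : R ↪ R') (g : C ↪ C') :
    cost M (s.map (f.prodMap g)) = cost (fun i j => M (f i) (g j)) s := by
  unfold cost
  rw [Finset.sum_map]
  rfl

theorem IsAssignment.exists_map_eq {k : ℕ} {t : Finset (R' × C')} (ht : IsAssignment k t)
    (f : R ↪ R') (g : C ↪ C') (h : ∀ p ∈ t, p.1 ∈ Set.range f ∧ p.2 ∈ Set.range g) :
    ∃ s, IsAssignment k s ∧ s.map (f.prodMap g) = t := by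
  have hsub : ∀ p ∈ t, p ∈ Set.range (f.prodMap g) := by
    rintro ⟨a, b⟩ hp
    obtain ⟨⟨i, hi⟩, ⟨j, hj⟩⟩ := h _ hp
    exact ⟨(i, j), Prod.ext hi hj⟩
  have hs : (t.preimage (f.prodMap g) (f.prodMap g).injective.injOn).map (f.prodMap g) = t := by
    ext p
    simp only [Finset.mem_map, Finset.mem_preimage]
    constructor
    · rintro ⟨a, ha, rfl⟩; exact ha
    · intro hp
      obtain ⟨a, rfl⟩ := hsub p hp
      exact ⟨a, hp, rfl⟩
  refine ⟨_, ⟨?_, ?_⟩, hs⟩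
  · intro p hp q hq hpq
    rw [Finset.mem_preimage] at hp hq
    have := ht.1 _ hp _ hq fun e => hpq ((f.prodMap g).injective e)
    exact ⟨fun e => this.1 (congrArg f e), fun e => this.2 (congrArg g e)⟩
  · rw [← Finset.card_map (f.prodMap g), hs, ht.2]

theorem minK_le_cost [Finite R] [Finite C] {k : ℕ} (M : R → C → ℝ) {s : Finset (R × C)}
    (hs : IsAssignment k s) : minK k M ≤ cost M s :=
  csInf_le ((Set.toFinite {s : Finset (R × C) | IsAssignment k s}).image (cost M)).bddBelow
    ⟨s, hs, rfl⟩

variable [DecidableEq R] [DecidableEq C]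

omit [DecidableEq R] [DecidableEq C] in
theorem IsAssignment.insert_site [DecidableEq R'] {k : ℕ} {s : Finset (R × C)}
    (hs : IsAssignment k s) {i : R'} {j : C'} [DecidableEq C'] {f : R ↪ R'} {g : C ↪ C'}
    (hi : i ∉ Set.range f) (hj : j ∉ Set.range g) (M : R' → C' → ℝ) :
    IsAssignment (k + 1) (insert (i, j) (s.map (f.prodMap g))) ∧
      cost M (insert (i, j) (s.map (f.prodMap g))) =
        M i j + cost (fun i j => M (f i) (g j)) s := by
  have hmem : ∀ p ∈ s.map (f.prodMap g), i ≠ p.1 ∧ j ≠ p.2 := by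
    intro p hp
    obtain ⟨a, -, rfl⟩ := Finset.mem_map.1 hp
    exact ⟨fun e => hi ⟨a.1, e.symm⟩, fun e => hj ⟨a.2, e.symm⟩⟩
  have hnot : (i, j) ∉ s.map (f.prodMap g) := fun h => (hmem _ h).1 rfl
  refine ⟨⟨?_, by rw [Finset.card_insert_of_notMem hnot, Finset.card_map, hs.2]⟩, ?_⟩
  · intro p hp q hq hpq
    rw [Finset.mem_insert] at hp hq
    rcases hp with rfl | hp <;> rcases hq with rfl | hq
    · exact absurd rfl hpq
    · exact hmem q hq
    · exact ⟨(hmem p hp).1.symm, (hmem p hp).2.symm⟩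
    · exact (hs.map f g).1 p hp q hq hpq
  · rw [← cost_map]
    exact Finset.sum_insert hnot

variable [Fintype R] [Fintype C]

/-- Some optimal assignment avoids the extra row if and only if no site of that row improves on
the minimum over the other rows. -/
theorem exists_isOptimalRows_map_some_iff {k : ℕ} (hR : k + 1 ≤ Fintype.card R)
    (hC : k + 1 ≤ Fintype.card C) (M : Option R → C → ℝ) :
    (∃ Z : Finset R, IsOptimalRows (k + 1) (Z.map Function.Embedding.some) M) ↔
      ∀ j, minK (k + 1) (fun i c => M (some i) c) ≤
        M none j + minK k (fun i (c : {c // c ≠ j}) => M (some i) c) := by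
  have hC' : ∀ j : C, k ≤ Fintype.card {c // c ≠ j} := fun j => by
    rw [Fintype.card_subtype_compl, Fintype.card_subtype_eq]; omega
  have hR' : k + 1 ≤ Fintype.card (Option R) := by rw [Fintype.card_option]; omega
  have hnone : (none : Option R) ∉ Set.range (Function.Embedding.some : R ↪ Option R) := by
    simp
  constructor
  · rintro ⟨Z, t, ht, htZ⟩ j
    obtain ⟨s, hs, rfl⟩ := ht.1.exists_map_eq Function.Embedding.some (Function.Embedding.refl C)
      (fun p hp => ⟨by
        have h := fst_mem_rows hp
        rw [htZ] at h
        obtain ⟨a, -, ha⟩ := Finset.mem_map.1 h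
        exact ⟨a, ha⟩, ⟨p.2, rfl⟩⟩)
    -- The competitor to `t` is an optimal `k`-assignment of old rows off column `j`, completed by
    -- `(none, j)`.
    obtain ⟨u, hu, huc⟩ := exists_isOptimal (Nat.le_of_succ_le hR) (hC' j)
      (fun i (c : {c // c ≠ j}) => M (some i) c)
    obtain ⟨h1, h2⟩ := hu.1.insert_site (i := (none : Option R)) (j := j)
      (f := Function.Embedding.some) (g := Function.Embedding.subtype _) hnone (by simp) M
    calc minK (k + 1) (fun i c => M (some i) c) ≤ cost (fun i c => M (some i) c) s :=
          minK_le_cost _ hs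
      _ = cost M (s.map (Function.Embedding.some.prodMap (Function.Embedding.refl C))) :=
          (cost_map M s Function.Embedding.some (Function.Embedding.refl C)).symm
      _ ≤ _ := ht.2 _ h1
      _ = _ := by rw [h2, ← huc]; rfl
  · intro h
    obtain ⟨t, ht, htc⟩ := exists_isOptimal hR' hC M
    by_cases hnt : none ∈ rows t
    · obtain ⟨j, hj⟩ := mem_rows.1 hnt
      have hte : IsAssignment k (t.erase (none, j)) :=
        ⟨ht.1.1.mono (Finset.erase_subset _ _), by
          rw [Finset.card_erase_of_mem hj, ht.1.2]; rfl⟩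
      obtain ⟨u, hu, hut⟩ := hte.exists_map_eq Function.Embedding.some
        (Function.Embedding.subtype fun c => c ≠ j) (by
          intro p hp
          rw [Finset.mem_erase] at hp
          have := ht.1.1 p hp.2 _ hj hp.1
          exact ⟨by simpa [Option.ne_none_iff_exists] using this.1, ⟨⟨p.2, this.2⟩, rfl⟩⟩)
      -- By the inequality for column `j`, an optimal assignment of the old rows costs no more than
      -- `t`.
      obtain ⟨s, hs, hsc⟩ := exists_isOptimal hR hC (fun i c => M (some i) c)
      refine ⟨rows s, s.map (Function.Embedding.some.prodMap (Function.Embedding.refl C)),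
        ⟨hs.1.map _ _, fun v hv => ?_⟩, ?_⟩
      · refine le_trans ?_ (ht.2 v hv)
        have e1 : cost M t = M none j + cost M (t.erase (none, j)) :=
          (Finset.add_sum_erase _ _ hj).symm
        have e2 := minK_le_cost (fun i (c : {c // c ≠ j}) => M (some i) c) hu
        rw [cost_map, e1, ← hut, cost_map]
        have := h j
        calc _ = minK (k + 1) (fun i c => M (some i) c) := hsc
          _ ≤ _ := this
          _ ≤ _ := by gcongr; exact e2
      · ext o
        simp only [rows, Finset.map_eq_image, Finset.image_image]
        rfl
    · obtain ⟨s, hs, rfl⟩ := ht.1.exists_map_eq Function.Embedding.some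
        (Function.Embedding.refl C) (fun p hp => ⟨by
          have h1 : p.1 ≠ none := fun e => hnt (e ▸ fst_mem_rows hp)
          simpa [Option.ne_none_iff_exists] using h1, ⟨p.2, rfl⟩⟩)
      refine ⟨rows s, _, ht, ?_⟩
      simp only [rows, Finset.map_eq_image, Finset.image_image]
      rfl

/-- From an optimal `(k + 1)`-assignment drop the site in column `j`, or an arbitrary one if that
column is unused. -/
theorem minK_delete_column_le {k : ℕ} (hR : k + 1 ≤ Fintype.card R)
    (hC : k + 1 ≤ Fintype.card C) {M : R → C → ℝ} (hM : ∀ i j, 0 ≤ M i j) (j : C) :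
    minK k (fun i (c : {c // c ≠ j}) => M i c) ≤ minK (k + 1) M := by
  obtain ⟨t, ht, htc⟩ := exists_isOptimal hR hC M
  obtain ⟨p, hp, hpt⟩ : ∃ p ∈ t, ∀ q ∈ t, q ≠ p → q.2 ≠ j := by
    by_cases h : ∃ p ∈ t, p.2 = j
    · obtain ⟨p, hp, hpj⟩ := h
      exact ⟨p, hp, fun q hq hqp e => hqp (ht.1.1.eq_of_snd hq hp (e.trans hpj.symm))⟩
    · obtain ⟨p, hp⟩ : t.Nonempty := Finset.card_pos.1 (by rw [ht.1.2]; omega)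
      exact ⟨p, hp, fun q hq _ e => h ⟨q, hq, e⟩⟩
  have hte : IsAssignment k (t.erase p) :=
    ⟨ht.1.1.mono (Finset.erase_subset _ _), by
      rw [Finset.card_erase_of_mem hp, ht.1.2]; rfl⟩
  obtain ⟨u, hu, hut⟩ := hte.exists_map_eq (Function.Embedding.refl R)
    (Function.Embedding.subtype fun c => c ≠ j) (by
      intro q hq
      rw [Finset.mem_erase] at hq
      exact ⟨⟨q.1, rfl⟩, ⟨⟨q.2, hpt q hq.2 hq.1⟩, rfl⟩⟩)
  have e1 : M p.1 p.2 + cost M (t.erase p) = cost M t :=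
    Finset.add_sum_erase t (fun p => M p.1 p.2) hp
  have e2 := minK_le_cost (fun i (c : {c // c ≠ j}) => M i c) hu
  have e3 : cost M (t.erase p) = cost (fun i (c : {c // c ≠ j}) => M i c) u := by
    rw [← hut, cost_map]; rfl
  have := hM p.1 p.2
  linarith

end Transport

/-! ### Laplace transform of the column gap and the recursion in `k`. -/

section Expectation

variable {R C : Type*} [Fintype R] [Fintype C]

theorem measurable_minK {k : ℕ} (hR : k ≤ Fintype.card R) (hC : k ≤ Fintype.card C) :
    Measurable fun f : R × C → ℝ => minK k (Function.curry f) := by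
  refine measurable_of_Iic fun x => ?_
  have : (fun f : R × C → ℝ => minK k (Function.curry f)) ⁻¹' Set.Iic x =
      {f | ∃ s, IsAssignment k s ∧ cost (Function.curry f) s ≤ x} := by
    ext f
    constructor
    · intro h
      obtain ⟨s, hs, hsc⟩ := exists_isOptimal hR hC (Function.curry f)
      exact ⟨s, hs.1, hsc ▸ h⟩
    · rintro ⟨s, hs, hsx⟩
      exact (minK_le_cost _ hs).trans hsx
  rw [this]
  refine measurableSet_setOfPred.2 (Measurable.exists fun s => measurable_const.and ?_)
  exact measurableSet_setOfPred.1 (measurableSet_le (measurable_cost s) measurable_const)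

theorem abs_minK_le {k : ℕ} (hR : k ≤ Fintype.card R) (hC : k ≤ Fintype.card C)
    (f : R × C → ℝ) : |minK k (Function.curry f)| ≤ ∑ p, |f p| := by
  obtain ⟨s, hs, hsc⟩ := exists_isOptimal hR hC (Function.curry f)
  rw [← hsc]
  refine (Finset.abs_sum_le_sum_abs _ _).trans ?_
  exact Finset.sum_le_sum_of_subset_of_nonneg (Finset.subset_univ s) fun p _ _ => abs_nonneg _

variable {wR : R → ℝ} {wC : C → ℝ}

theorem measurePreserving_eval_matrixMeasure (hwR : ∀ i, 0 < wR i) (hwC : ∀ j, 0 < wC j)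
    (p : R × C) :
    MeasurePreserving (Function.eval p) (matrixMeasure wR wC)
      (expMeasure (wR p.1 * wC p.2)) := by
  have : ∀ p : R × C, IsProbabilityMeasure (expMeasure (wR p.1 * wC p.2)) := fun p =>
    isProbabilityMeasure_expMeasure (mul_pos (hwR _) (hwC _))
  exact measurePreserving_eval (fun p : R × C => expMeasure (wR p.1 * wC p.2)) p

theorem ae_nonneg_matrixMeasure (hwR : ∀ i, 0 < wR i) (hwC : ∀ j, 0 < wC j) :
    ∀ᵐ f ∂(matrixMeasure wR wC), ∀ p, 0 ≤ f p := by
  rw [ae_all_iff]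
  intro p
  have h : ∀ᵐ x ∂(expMeasure (wR p.1 * wC p.2)), 0 ≤ x := by
    rw [ae_iff, ← expMeasure_Iio_zero (wR p.1 * wC p.2)]
    congr 1
    ext x
    simp
  exact (measurePreserving_eval_matrixMeasure hwR hwC p).quasiMeasurePreserving.ae h

theorem integrable_minK_matrixMeasure (hwR : ∀ i, 0 < wR i) (hwC : ∀ j, 0 < wC j) {k : ℕ}
    (hR : k ≤ Fintype.card R) (hC : k ≤ Fintype.card C) :
    Integrable (fun f => minK k (Function.curry f)) (matrixMeasure wR wC) := by
  refine Integrable.mono' (g := fun f => ∑ p, |f p|) ?_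
    (measurable_minK hR hC).aestronglyMeasurable
    (Filter.Eventually.of_forall fun f => abs_minK_le hR hC f)
  refine integrable_finsetSum _ fun p _ => Integrable.abs ?_
  have hp := measurePreserving_eval_matrixMeasure hwR hwC p
  exact (hp.integrable_comp aestronglyMeasurable_id).2
    (integrable_id_expMeasure (mul_pos (hwR p.1) (hwC p.2)))

theorem hasLaw_matrixMeasure {Ω : Type*} [MeasurableSpace Ω] {μ : Measure Ω}
    [IsProbabilityMeasure μ] {M : R × C → Ω → ℝ}
    (hlaw : ∀ p, HasLaw (M p) (expMeasure (wR p.1 * wC p.2)) μ) (hindep : iIndepFun M μ) :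
    HasLaw (fun ω p => M p ω) (matrixMeasure wR wC) μ := by
  refine ⟨aemeasurable_pi_lambda _ fun p => (hlaw p).aemeasurable, ?_⟩
  rw [(iIndepFun_iff_map_fun_eq_pi_map fun p => (hlaw p).aemeasurable).1 hindep]
  unfold matrixMeasure
  congr 1
  funext p
  exact (hlaw p).map_eq

theorem hasLaw_matrixMeasure_delete [DecidableEq C] (hwR : ∀ i, 0 < wR i) (hwC : ∀ j, 0 < wC j) (j : C) :
    HasLaw (fun (f : R × C → ℝ) (p : R × {c // c ≠ j}) => f (p.1, p.2))
      (matrixMeasure wR fun c : {c // c ≠ j} => wC c) (matrixMeasure wR wC) := by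
  have hp : ∀ p : R × C, IsProbabilityMeasure (expMeasure (wR p.1 * wC p.2)) := fun p =>
    isProbabilityMeasure_expMeasure (mul_pos (hwR _) (hwC _))
  have := isProbabilityMeasure_matrixMeasure hwR hwC
  refine hasLaw_matrixMeasure (fun p => ?_) ?_
  · have h := measurePreserving_eval_matrixMeasure hwR hwC (p.1, (p.2 : C))
    exact ⟨h.measurable.aemeasurable, h.map_eq⟩
  · have h : iIndepFun (fun (p : R × C) (f : R × C → ℝ) => f p) (matrixMeasure wR wC) :=
      iIndepFun_pi (X := fun _ => id) fun _ => aemeasurable_id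
    exact h.precomp (g := fun p : R × {c // c ≠ j} => (p.1, (p.2 : C)))
      fun p q e => Prod.ext (Prod.mk.inj e).1 (Subtype.ext (Prod.mk.inj e).2)

/-- Adding an independent row of weight `q` to the matrix. -/
theorem map_addRow_matrixMeasure (hwR : ∀ i, 0 < wR i) (hwC : ∀ j, 0 < wC j) {q : ℝ}
    (hq : 0 < q) :
    ((matrixMeasure wR wC).prod (Measure.pi fun j => expMeasure (q * wC j))).map
        (fun x (p : Option R × C) => p.1.elim (x.2 p.2) fun i => x.1 (i, p.2)) =
      matrixMeasure (fun o : Option R => o.elim q wR) wC := by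
  have h1 : ∀ p : R × C, IsProbabilityMeasure (expMeasure (wR p.1 * wC p.2)) := fun p =>
    isProbabilityMeasure_expMeasure (mul_pos (hwR _) (hwC _))
  have h2 : ∀ j, IsProbabilityMeasure (expMeasure (q * wC j)) := fun j =>
    isProbabilityMeasure_expMeasure (mul_pos hq (hwC _))
  have h3 : ∀ p : Option R × C, IsProbabilityMeasure
      (expMeasure ((fun o : Option R => o.elim q wR) p.1 * wC p.2)) := by
    rintro ⟨_ | i, j⟩
    · exact h2 j
    · exact h1 (i, j)
  have hm : Measurable fun (x : (R × C → ℝ) × (C → ℝ)) (p : Option R × C) =>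
      p.1.elim (x.2 p.2) fun i => x.1 (i, p.2) := by
    refine measurable_pi_iff.2 ?_
    rintro ⟨_ | i, j⟩
    · exact (measurable_pi_apply j).comp measurable_snd
    · exact (measurable_pi_apply (i, j)).comp measurable_fst
  symm
  refine Measure.pi_eq fun s hs => ?_
  rw [Measure.map_apply hm (MeasurableSet.univ_pi hs)]
  have e : (fun (x : (R × C → ℝ) × (C → ℝ)) (p : Option R × C) =>
      p.1.elim (x.2 p.2) fun i => x.1 (i, p.2)) ⁻¹' Set.univ.pi s =
      (Set.univ.pi fun p : R × C => s (some p.1, p.2)) ×ˢ (Set.univ.pi fun j => s (none, j)) := by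
    ext x
    simp only [Set.mem_preimage, Set.mem_univ_pi, Set.mem_prod]
    constructor
    · intro h
      exact ⟨fun p => h (some p.1, p.2), fun j => h (none, j)⟩
    · rintro ⟨h, h'⟩ ⟨_ | i, j⟩
      · exact h' j
      · exact h (i, j)
  rw [e, Measure.prod_prod, matrixMeasure, Measure.pi_pi, Measure.pi_pi,
    Fintype.prod_prod_type, Fintype.prod_prod_type, Fintype.prod_option, mul_comm]
  rfl

variable [DecidableEq R] [DecidableEq C]

/-- The weighted total increase of the minimum caused by deleting a column and allowing one site
less. -/
noncomputable def columnGap (wC : C → ℝ) (k : ℕ) (f : R × C → ℝ) : ℝ :=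
  ∑ j, wC j * (minK (k + 1) (Function.curry f) -
    minK k fun i (c : {c // c ≠ j}) => f (i, c))

omit [Fintype R] [DecidableEq R] in
theorem card_ne (j : C) : Fintype.card {c // c ≠ j} = Fintype.card C - 1 := by
  rw [Fintype.card_subtype_compl, Fintype.card_subtype_eq]

omit [DecidableEq R] in
theorem measurable_minK_delete {k : ℕ} (hR : k ≤ Fintype.card R) (hC : k + 1 ≤ Fintype.card C)
    (j : C) : Measurable fun f : R × C → ℝ => minK k fun i (c : {c // c ≠ j}) => f (i, c) := by
  have hC' : k ≤ Fintype.card {c // c ≠ j} := by rw [card_ne]; omega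
  refine (measurable_minK hR hC').comp
    (g := fun f : R × {c // c ≠ j} → ℝ => minK k (Function.curry f))
    (f := fun (f : R × C → ℝ) (p : R × {c // c ≠ j}) => f (p.1, p.2)) ?_
  exact measurable_pi_iff.2 fun p => measurable_pi_apply _

omit [DecidableEq R] in
theorem measurable_columnGap {k : ℕ} (hR : k + 1 ≤ Fintype.card R)
    (hC : k + 1 ≤ Fintype.card C) : Measurable (columnGap (R := R) wC k) :=
  Finset.measurable_sum _ fun j _ => ((measurable_minK hR hC).sub
    (measurable_minK_delete (Nat.le_of_succ_le hR) hC j)).const_mul _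

omit [DecidableEq R] in
theorem integral_minK_delete (hwR : ∀ i, 0 < wR i) (hwC : ∀ j, 0 < wC j) {k : ℕ}
    (hR : k ≤ Fintype.card R) (hC : k + 1 ≤ Fintype.card C) (j : C) :
    Integrable (fun f => minK k fun i (c : {c // c ≠ j}) => f (i, c)) (matrixMeasure wR wC) ∧
      ∫ f, (minK k fun i (c : {c // c ≠ j}) => f (i, c)) ∂(matrixMeasure wR wC) =
        ∫ f, minK k (Function.curry f) ∂(matrixMeasure wR fun c : {c // c ≠ j} => wC c) := by
  have hC' : k ≤ Fintype.card {c // c ≠ j} := by rw [card_ne]; omega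
  have hlaw := hasLaw_matrixMeasure_delete hwR hwC j
  have hint := integrable_minK_matrixMeasure hwR (fun c : {c // c ≠ j} => hwC c) hR hC'
  constructor
  · rw [← hlaw.map_eq] at hint
    exact hint.comp_aemeasurable hlaw.aemeasurable
  · exact hlaw.integral_comp (measurable_minK hR hC').aestronglyMeasurable

/-- The Laplace transform of the column gap. -/
theorem integral_exp_columnGap (hwR : ∀ i, 0 < wR i) (hwC : ∀ j, 0 < wC j) {k : ℕ}
    (hR : k + 1 ≤ Fintype.card R) (hC : k + 1 ≤ Fintype.card C) {q : ℝ} (hq : 0 < q) :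
    ∫ f, Real.exp (-(q * columnGap wC k f)) ∂(matrixMeasure wR wC) =
      1 - q * ∑ l ∈ Finset.range (k + 1), ∑ Z ∈ Finset.univ.powersetCard l,
        soleTime wR q Z := by
  have h2 : ∀ j, IsProbabilityMeasure (expMeasure (q * wC j)) := fun j =>
    isProbabilityMeasure_expMeasure (mul_pos hq (hwC _))
  have hprob := isProbabilityMeasure_matrixMeasure hwR hwC
  let S : Set (Option R × C → ℝ) := {f | ∀ j, minK (k + 1) (fun i c => f (some i, c)) ≤
        f (none, j) + minK k (fun i (c : {c // c ≠ j}) => f (some i, c))}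
  have hrestr : Measurable fun (f : Option R × C → ℝ) (p : R × C) => f (some p.1, p.2) :=
    measurable_pi_iff.2 fun p => measurable_pi_apply _
  have hS : MeasurableSet S := by
    refine measurableSet_setOfPred.2 (Measurable.forall fun j => measurableSet_setOfPred.1 ?_)
    have hm₁ : Measurable ((fun f : R × C → ℝ => minK (k + 1) (Function.curry f)) ∘
        fun (f : Option R × C → ℝ) (p : R × C) => f (some p.1, p.2)) :=
      (measurable_minK hR hC).comp hrestr
    have hm₂ : Measurable ((fun f : R × C → ℝ => minK k fun i (c : {c // c ≠ j}) => f (i, c)) ∘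
        fun (f : Option R × C → ℝ) (p : R × C) => f (some p.1, p.2)) :=
      (measurable_minK_delete (Nat.le_of_succ_le hR) hC j).comp hrestr
    have hm₃ : Measurable fun f : Option R × C → ℝ => f (none, j) := measurable_pi_apply _
    exact measurableSet_le hm₁ (hm₃.add hm₂)
  have hSeq : {f | ∃ Z : Finset R, IsOptimalRows (k + 1) (Z.map Function.Embedding.some)
      (Function.curry f)} = S := by
    ext f
    exact exists_isOptimalRows_map_some_iff hR hC (Function.curry f)
  have hm : Measurable fun (x : (R × C → ℝ) × (C → ℝ)) (p : Option R × C) =>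
      p.1.elim (x.2 p.2) fun i => x.1 (i, p.2) := by
    refine measurable_pi_iff.2 ?_
    rintro ⟨_ | i, j⟩
    · exact (measurable_pi_apply j).comp measurable_snd
    · exact (measurable_pi_apply (i, j)).comp measurable_fst
  have hexp : Measurable fun f : R × C → ℝ => Real.exp (-(q * columnGap wC k f)) :=
    Real.measurable_exp.comp ((measurable_columnGap hR hC).const_mul q).neg
  rw [← matrixMeasure_option_isOptimalRows hwR hwC hq hR hC, hSeq,
    ← map_addRow_matrixMeasure hwR hwC hq, measureReal_def, Measure.map_apply hm hS,
    Measure.prod_apply (hm hS), integral_eq_lintegral_of_nonneg_ae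
      (Filter.Eventually.of_forall fun f => (Real.exp_pos _).le)
      hexp.aestronglyMeasurable]
  congr 1
  refine lintegral_congr_ae ?_
  filter_upwards [ae_nonneg_matrixMeasure hwR hwC] with f hf
  -- For fixed `f` the event is a product of half-lines in the entries of the extra row. The gaps
  -- are nonnegative, so their exponential tails multiply to `exp (-(q * columnGap))`.
  have e : Prod.mk f ⁻¹' ((fun (x : (R × C → ℝ) × (C → ℝ)) (p : Option R × C) =>
      p.1.elim (x.2 p.2) fun i => x.1 (i, p.2)) ⁻¹' S) =
      Set.univ.pi fun j => Set.Ici (minK (k + 1) (Function.curry f) -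
        minK k fun i (c : {c // c ≠ j}) => f (i, c)) := by
    ext g
    simp only [Set.mem_univ_pi, Set.mem_Ici, sub_le_iff_le_add]
    rfl
  have hgap : ∀ j, 0 ≤ minK (k + 1) (Function.curry f) -
      minK k fun i (c : {c // c ≠ j}) => f (i, c) := fun j =>
    sub_nonneg.2 (minK_delete_column_le hR hC (fun i j => hf (i, j)) j)
  rw [e, Measure.pi_pi, columnGap]
  simp only [expMeasure_Ici (mul_pos hq (hwC _)) (hgap _)]
  rw [← ENNReal.ofReal_prod_of_nonneg fun j _ => (Real.exp_pos _).le, ← Real.exp_sum,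
    Finset.mul_sum, ← Finset.sum_neg_distrib]
  simp only [mul_assoc]

/-- Every `V ⊆ Z` misses a row, so no denominator vanishes at `q = 0`. -/
theorem tendsto_soleTime {w : R → ℝ} (hw : ∀ i, 0 < w i) {Z : Finset R}
    (hZ : Z.card < Fintype.card R) {u : ℕ → ℝ} (hu : Filter.Tendsto u Filter.atTop (nhds 0)) :
    Filter.Tendsto (fun n => soleTime w (u n) Z) Filter.atTop (nhds (soleTime w 0 Z)) := by
  unfold soleTime
  refine tendsto_finsetSum _ fun V hV => Filter.Tendsto.div tendsto_const_nhds
    (hu.add tendsto_const_nhds) ?_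
  have hV' : Vᶜ.Nonempty := by
    rw [← Finset.card_pos, Finset.card_compl]
    have := Finset.card_le_card (Finset.mem_powerset.1 hV)
    omega
  have := Finset.sum_pos (fun i _ => hw i) hV'
  linarith

/-- The expectation is minus the derivative of the Laplace transform at zero; `1 - exp (-x) ≤ x`
bounds the difference quotients by `H`. -/
theorem tendsto_integral_laplace {Ω : Type*} [MeasurableSpace Ω] {μ : Measure Ω}
    [IsProbabilityMeasure μ] {H : Ω → ℝ} (hint : Integrable H μ) (hnn : ∀ᵐ ω ∂μ, 0 ≤ H ω)
    {u : ℕ → ℝ} (hpos : ∀ n, 0 < u n) (hu : Filter.Tendsto u Filter.atTop (nhds 0)) :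
    Filter.Tendsto (fun n => (1 - ∫ ω, Real.exp (-(u n * H ω)) ∂μ) / u n) Filter.atTop
      (nhds (∫ ω, H ω ∂μ)) := by
  have hmeas : ∀ n, AEStronglyMeasurable (fun ω => Real.exp (-(u n * H ω))) μ := fun n =>
    Real.continuous_exp.comp_aestronglyMeasurable (hint.1.const_mul (u n)).neg
  have hexp : ∀ n, Integrable (fun ω => Real.exp (-(u n * H ω))) μ := by
    intro n
    refine Integrable.mono' (integrable_const (1 : ℝ)) (hmeas n) ?_
    filter_upwards [hnn] with ω hω
    rw [Real.norm_of_nonneg (Real.exp_pos _).le, Real.exp_le_one_iff]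
    have := mul_nonneg (hpos n).le hω
    linarith
  have h1 : ∀ n, (1 - ∫ ω, Real.exp (-(u n * H ω)) ∂μ) / u n =
      ∫ ω, (1 - Real.exp (-(u n * H ω))) / u n ∂μ := by
    intro n
    rw [integral_div, integral_sub (integrable_const _) (hexp n)]
    simp
  simp only [h1]
  refine tendsto_integral_of_dominated_convergence H
    (fun n => ((aestronglyMeasurable_const.sub (hmeas n)).mul_const (u n)⁻¹).congr
      (Filter.Eventually.of_forall fun ω => (div_eq_mul_inv _ _).symm)) hint ?_ ?_
  · intro n
    filter_upwards [hnn] with ω hω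
    have h0 := mul_nonneg (hpos n).le hω
    rw [Real.norm_of_nonneg, div_le_iff₀ (hpos n)]
    · have := Real.one_sub_le_exp_neg (u n * H ω)
      linarith
    · refine div_nonneg (sub_nonneg.2 (Real.exp_le_one_iff.2 ?_)) (hpos n).le
      linarith
  · refine Filter.Eventually.of_forall fun ω => ?_
    have hd : HasDerivAt (fun x : ℝ => -Real.exp (-(x * H ω))) (H ω) 0 := by
      have h := ((hasDerivAt_mul_const (x := (0 : ℝ)) (H ω)).neg.exp).neg
      exact h.congr_deriv (by simp)
    have hu' : Filter.Tendsto u Filter.atTop (nhdsWithin 0 {0}ᶜ) :=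
      tendsto_nhdsWithin_iff.2 ⟨hu, Filter.Eventually.of_forall fun n => (hpos n).ne'⟩
    refine ((hasDerivAt_iff_tendsto_slope.1 hd).comp hu').congr fun n => ?_
    simp only [Function.comp_apply, slope_def_field, zero_mul, neg_zero, Real.exp_zero, sub_zero]
    ring

/-- The first-order term in `q` of the two expressions for the same probability. -/
theorem integral_columnGap (hwR : ∀ i, 0 < wR i) (hwC : ∀ j, 0 < wC j) {k : ℕ}
    (hR : k + 1 ≤ Fintype.card R) (hC : k + 1 ≤ Fintype.card C) :
    ∫ f, columnGap wC k f ∂(matrixMeasure wR wC) =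
      ∑ l ∈ Finset.range (k + 1), ∑ Z ∈ Finset.univ.powersetCard l, soleTime wR 0 Z := by
  have hprob := isProbabilityMeasure_matrixMeasure hwR hwC
  have hpos : ∀ n : ℕ, (0 : ℝ) < 1 / ((n : ℝ) + 1) := fun n => by positivity
  have hu := tendsto_one_div_add_atTop_nhds_zero_nat (𝕜 := ℝ)
  have hint : Integrable (columnGap wC k) (matrixMeasure wR wC) :=
    integrable_finsetSum _ fun j _ => ((integrable_minK_matrixMeasure hwR hwC hR hC).sub
      (integral_minK_delete hwR hwC (Nat.le_of_succ_le hR) hC j).1).const_mul _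
  refine tendsto_nhds_unique (tendsto_integral_laplace hint ?_ hpos hu) ?_
  · filter_upwards [ae_nonneg_matrixMeasure hwR hwC] with f hf
    exact Finset.sum_nonneg fun j _ => mul_nonneg (hwC j).le
      (sub_nonneg.2 (minK_delete_column_le hR hC (fun i j => hf (i, j)) j))
  · have h : Filter.Tendsto (fun n : ℕ => ∑ l ∈ Finset.range (k + 1),
        ∑ Z ∈ Finset.univ.powersetCard l, soleTime wR (1 / ((n : ℝ) + 1)) Z) Filter.atTop
        (nhds (∑ l ∈ Finset.range (k + 1), ∑ Z ∈ Finset.univ.powersetCard l,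
          soleTime wR 0 Z)) := by
      refine tendsto_finsetSum _ fun l hl => tendsto_finsetSum _ fun Z hZ =>
        tendsto_soleTime hwR ?_ hu
      rw [Finset.mem_range] at hl
      rw [(Finset.mem_powersetCard.1 hZ).2]
      omega
    refine h.congr fun n => ?_
    rw [integral_exp_columnGap hwR hwC hR hC (hpos n)]
    have := (hpos n).ne'
    field_simp
    ring

/-- Deleting a column chosen with probability proportional to its weight. -/
theorem integral_minK_succ (hwR : ∀ i, 0 < wR i) (hwC : ∀ j, 0 < wC j) {k : ℕ}
    (hR : k + 1 ≤ Fintype.card R) (hC : k + 1 ≤ Fintype.card C) :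
    (∑ j, wC j) * ∫ f, minK (k + 1) (Function.curry f) ∂(matrixMeasure wR wC) =
      ∑ j, wC j * ∫ f, minK k (Function.curry f)
          ∂(matrixMeasure wR fun c : {c // c ≠ j} => wC c) +
        ∑ l ∈ Finset.range (k + 1), ∑ Z ∈ Finset.univ.powersetCard l, soleTime wR 0 Z := by
  have h1 := integrable_minK_matrixMeasure hwR hwC hR hC
  have h2 := fun j => integral_minK_delete hwR hwC (Nat.le_of_succ_le hR) hC j
  have h3 := integral_columnGap hwR hwC hR hC
  unfold columnGap at h3
  have h4 : ∀ j ∈ Finset.univ, Integrable (fun f : R × C → ℝ => wC j * (minK (k + 1) (Function.curry f) -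
      minK k fun i (c : {c // c ≠ j}) => f (i, c))) (matrixMeasure wR wC) := fun j _ =>
    (h1.sub (h2 j).1).const_mul _
  rw [integral_finsetSum _ h4] at h3
  rw [← h3, Finset.sum_mul, ← Finset.sum_add_distrib]
  refine Finset.sum_congr rfl fun j _ => ?_
  rw [integral_const_mul, integral_sub h1 (h2 j).1, (h2 j).2]
  ring

end Expectation

/-! ### Signed binomial coefficients and the closed formula. -/

section Formula

/-- The binomial coefficient with the sign of its lower index. -/
noncomputable def signedBinom (a b : ℤ) : ℝ := (-1) ^ b * (binom a b : ℝ)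

theorem signedBinom_of_neg (a : ℤ) {b : ℤ} (hb : b < 0) : signedBinom a b = 0 := by
  simp [signedBinom, binom, hb]

theorem signedBinom_natCast (a : ℤ) (b : ℕ) :
    signedBinom a b = (-1) ^ b * ((Ring.choose a b : ℤ) : ℝ) := by
  have : ¬ ((b : ℤ) < 0) := by omega
  simp [signedBinom, binom, this]

theorem signedBinom_succ (a b : ℤ) :
    signedBinom (a + 1) b = signedBinom a b - signedBinom a (b - 1) := by
  rcases lt_or_ge b 0 with hb | hb
  · rw [signedBinom_of_neg _ hb, signedBinom_of_neg _ hb, signedBinom_of_neg _ (by omega), sub_zero]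
  · obtain ⟨n, rfl⟩ := Int.eq_ofNat_of_zero_le hb
    cases n with
    | zero =>
      rw [signedBinom_of_neg a (b := ((0 : ℕ) : ℤ) - 1) (by omega), signedBinom_natCast,
        signedBinom_natCast]
      simp
    | succ n =>
      have : ((n + 1 : ℕ) : ℤ) - 1 = n := by push_cast; ring
      rw [this, signedBinom_natCast, signedBinom_natCast, signedBinom_natCast,
        Ring.choose_succ_succ]
      push_cast
      ring

/-- Each element of `T`, lying in `Y` or not, reverses one application of Pascal's rule. -/
theorem sum_powerset_signedBinom {α : Type*} [DecidableEq α] (T : Finset α) (a b : ℤ) :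
    ∑ Y ∈ T.powerset, signedBinom (a + T.card - Y.card) (b - Y.card) = signedBinom a b := by
  induction T using Finset.induction_on with
  | empty => simp
  | insert j T hj ih =>
    rw [Finset.sum_powerset_insert hj, ← ih, ← Finset.sum_add_distrib]
    refine Finset.sum_congr rfl fun Y hY => ?_
    have hjY : j ∉ Y := fun h => hj (Finset.mem_powerset.1 hY h)
    rw [Finset.card_insert_of_notMem hj, Finset.card_insert_of_notMem hjY]
    have e1 : a + ((T.card + 1 : ℕ) : ℤ) - Y.card = a + T.card - Y.card + 1 := by push_cast; ring
    have e2 : a + ((T.card + 1 : ℕ) : ℤ) - ((Y.card + 1 : ℕ) : ℤ) = a + T.card - Y.card := by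
      push_cast; ring
    have e3 : b - ((Y.card + 1 : ℕ) : ℤ) = b - Y.card - 1 := by push_cast; ring
    rw [e1, e2, e3, signedBinom_succ]
    ring

theorem sum_powerset_neg_one_pow_card_le {α : Type*} [DecidableEq α] (T : Finset α) (b : ℤ) :
    ∑ U ∈ T.powerset, (if (U.card : ℤ) ≤ b then (-1 : ℝ) ^ U.card else 0) =
      signedBinom (T.card - 1) b := by
  induction T using Finset.induction_on generalizing b with
  | empty =>
    rcases lt_or_ge b 0 with hb | hb
    · rw [signedBinom_of_neg _ hb]; simp [hb]
    · obtain ⟨n, rfl⟩ := Int.eq_ofNat_of_zero_le hb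
      -- For empty `T` the upper index is `-1`; this value cancels the sign and leaves the
      -- contribution 1 of the empty set.
      have h : Ring.choose (-1 : ℤ) n = (-1) ^ n := by
        clear hb
        induction n with
        | zero => simp
        | succ n ih =>
          have h' := Ring.choose_succ_succ (-1 : ℤ) n
          rw [neg_add_cancel, Ring.choose_zero_succ, ih] at h'
          rw [pow_succ]
          linarith
      simp only [Finset.card_empty, Nat.cast_zero, zero_sub, signedBinom_natCast, h]
      push_cast
      rw [← mul_pow]
      simp
  | insert j T hj ih =>
    rw [Finset.sum_powerset_insert hj, Finset.card_insert_of_notMem hj]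
    have e : ((T.card + 1 : ℕ) : ℤ) - 1 = (T.card : ℤ) - 1 + 1 := by push_cast; ring
    rw [e, signedBinom_succ, ih, ← ih (b - 1),
      sub_eq_add_neg (signedBinom ((T.card : ℤ) - 1) b), ← Finset.sum_neg_distrib]
    congr 1
    refine Finset.sum_congr rfl fun U hU => ?_
    have hjU : j ∉ U := fun h => hj (Finset.mem_powerset.1 hU h)
    rw [Finset.card_insert_of_notMem hjU]
    by_cases h : (U.card : ℤ) ≤ b - 1
    · rw [if_pos h, if_pos (by push_cast; omega), pow_succ]; ring
    · rw [if_neg h, if_neg (by push_cast; omega), neg_zero]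

variable {R C : Type*} [Fintype R] [Fintype C] [DecidableEq R] [DecidableEq C]

omit [Fintype C] [DecidableEq C] in
-- Once the sums are exchanged, the numerator over `V` is a truncated alternating sum over the sets
-- `Z \ V` inside `Vᶜ`.
theorem sum_soleTime (w : R → ℝ) (k : ℕ) :
    ∑ l ∈ Finset.range (k + 1), ∑ Z ∈ Finset.univ.powersetCard l, soleTime w 0 Z =
      ∑ V : Finset R, signedBinom (Fintype.card R - 1 - V.card) (k - V.card) /
        ∑ i ∈ Vᶜ, w i := by
  have h1 : ∑ l ∈ Finset.range (k + 1), ∑ Z ∈ Finset.univ.powersetCard l, soleTime w 0 Z =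
      ∑ Z ∈ Finset.univ.filter (fun Z : Finset R => Z.card ≤ k), soleTime w 0 Z := by
    rw [← Finset.sum_fiberwise_of_maps_to (s := Finset.univ.filter fun Z : Finset R => Z.card ≤ k)
      (t := Finset.range (k + 1)) (g := Finset.card)
      (fun Z hZ => by simpa [Nat.lt_succ_iff] using hZ)]
    refine Finset.sum_congr rfl fun l hl => Finset.sum_congr ?_ fun _ _ => rfl
    rw [Finset.mem_range] at hl
    ext Z
    simp only [Finset.mem_powersetCard, Finset.subset_univ, true_and, Finset.mem_filter,
      Finset.mem_univ]
    omega
  rw [h1]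
  unfold soleTime
  rw [Finset.sum_comm' (t' := Finset.univ)
    (s' := fun V => Finset.univ.filter fun Z : Finset R => V ⊆ Z ∧ Z.card ≤ k)
    (by intro Z V; simp [and_comm])]
  refine Finset.sum_congr rfl fun V _ => ?_
  simp only [zero_add]
  rw [← Finset.sum_div]
  congr 1
  have h2 := sum_powerset_neg_one_pow_card_le Vᶜ (k - V.card)
  rw [← Finset.sum_filter, Finset.card_compl, Nat.cast_sub (Finset.card_le_univ V)] at h2
  rw [sub_right_comm, ← h2]
  refine Finset.sum_bij' (fun Z _ => Z \ V) (fun U _ => U ∪ V) ?_ ?_ ?_ ?_ ?_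
  · intro Z hZ
    simp only [Finset.mem_filter, Finset.mem_univ, true_and, Finset.mem_powerset] at hZ ⊢
    have := Finset.card_sdiff_add_card_eq_card hZ.1
    refine ⟨fun i hi => Finset.mem_compl.2 (Finset.mem_sdiff.1 hi).2, by omega⟩
  · intro U hU
    simp only [Finset.mem_filter, Finset.mem_univ, true_and, Finset.mem_powerset] at hU ⊢
    have := Finset.card_union_le U V
    exact ⟨Finset.subset_union_right, by omega⟩
  · intro Z hZ
    simp only [Finset.mem_filter, Finset.mem_univ, true_and] at hZ
    exact Finset.sdiff_union_of_subset hZ.1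
  · intro U hU
    simp only [Finset.mem_filter, Finset.mem_powerset] at hU
    refine Finset.union_sdiff_cancel_right ?_
    rw [Finset.disjoint_left]
    exact fun i hi => Finset.mem_compl.1 (hU.1 hi)
  · intro Z hZ
    simp only [Finset.mem_filter, Finset.mem_univ, true_and] at hZ
    have := Finset.card_sdiff_add_card_eq_card hZ.1
    rw [← this, add_assoc, pow_add, ← two_mul, pow_mul]
    simp

/-- A set avoiding `j` corresponds to a set of columns with the marked element `j`. -/
theorem sum_delete_insert (w : C → ℝ) (g : Finset C → ℝ) :
    ∑ j, w j * ∑ Y : Finset {c // c ≠ j}, g (insert j (Y.map (Function.Embedding.subtype _))) =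
      ∑ Y : Finset C, (∑ j ∈ Y, w j) * g Y := by
  simp only [Finset.sum_mul, Finset.mul_sum]
  rw [Finset.sum_comm' (s := (Finset.univ : Finset (Finset C))) (t := fun Y => Y)
    (t' := Finset.univ) (s' := fun j => Finset.univ.filter fun Y : Finset C => j ∈ Y)
    (by intro Y j; simp)]
  refine Finset.sum_congr rfl fun j _ => ?_
  refine Finset.sum_bij' (fun Y _ => insert j (Y.map (Function.Embedding.subtype _)))
    (fun Y _ => Y.subtype fun c => c ≠ j) ?_ ?_ ?_ ?_ ?_
  · intro Y _; simp
  · intro Y _; simp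
  · intro Y _
    ext c
    have := c.2
    simp
    tauto
  · intro Y hY
    simp only [Finset.mem_filter, Finset.mem_univ, true_and] at hY
    ext c
    by_cases hc : c = j
    · simp [hc, hY]
    · simp [hc]
  · intro Y _; rfl

/-- The closed formula for the expected minimum. -/
noncomputable def expectedMinFormula (wR : R → ℝ) (wC : C → ℝ) (k : ℕ) : ℝ :=
  ∑ X : Finset R, ∑ Y : Finset C,
    signedBinom (Fintype.card R + Fintype.card C - 1 - X.card - Y.card) (k - 1 - X.card - Y.card) /
      ((∑ i ∈ Xᶜ, wR i) * ∑ j ∈ Yᶜ, wC j)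

/-- Split the total column weight into the weights of `Y` and `Yᶜ`. The first part gives the
formulas with a column deleted, `Y` being enlarged by that column. The second cancels the column
denominator, and the sum over `Y` collapses by `sum_powerset_signedBinom`. -/
theorem expectedMinFormula_succ (wR : R → ℝ) {wC : C → ℝ} (hwC : ∀ j, 0 < wC j) {k : ℕ}
    (hC : k + 1 ≤ Fintype.card C) :
    (∑ j, wC j) * expectedMinFormula wR wC (k + 1) =
      ∑ j, wC j * expectedMinFormula wR (fun c : {c // c ≠ j} => wC c) k +
        ∑ X : Finset R, signedBinom (Fintype.card R - 1 - X.card) (k - X.card) /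
          ∑ i ∈ Xᶜ, wR i := by
  let g : Finset R → Finset C → ℝ := fun X Y =>
    signedBinom (Fintype.card R + Fintype.card C - 1 - X.card - Y.card) (k - X.card - Y.card) /
      ((∑ i ∈ Xᶜ, wR i) * ∑ j ∈ Yᶜ, wC j)
  have h1 : ∑ j, wC j * expectedMinFormula wR (fun c : {c // c ≠ j} => wC c) k =
      ∑ X : Finset R, ∑ Y : Finset C, (∑ j ∈ Y, wC j) * g X Y := by
    simp only [← sum_delete_insert wC]
    rw [Finset.sum_comm]
    refine Finset.sum_congr rfl fun j _ => ?_
    rw [expectedMinFormula, Finset.mul_sum]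
    refine Finset.sum_congr rfl fun X _ => ?_
    congr 1
    refine Finset.sum_congr rfl fun Y _ => ?_
    have hj : j ∉ Y.map (Function.Embedding.subtype fun c => c ≠ j) := by simp
    have hc : ∑ c ∈ (insert j (Y.map (Function.Embedding.subtype fun c => c ≠ j)))ᶜ, wC c =
        ∑ c ∈ Yᶜ, wC c := by
      have : (insert j (Y.map (Function.Embedding.subtype fun c => c ≠ j)))ᶜ =
          Yᶜ.map (Function.Embedding.subtype fun c => c ≠ j) := by
        ext c
        by_cases hc : c = j
        · simp [hc]
        · simp [hc]
      rw [this, Finset.sum_map]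
      rfl
    simp only [g]
    rw [hc, Finset.card_insert_of_notMem hj, Finset.card_map, card_ne,
      Nat.cast_sub (by omega : 1 ≤ Fintype.card C)]
    congr 2 <;> push_cast <;> ring
  have h2 : (∑ j, wC j) * expectedMinFormula wR wC (k + 1) =
      ∑ X : Finset R, ∑ Y : Finset C, ((∑ j ∈ Y, wC j) * g X Y + (∑ j ∈ Yᶜ, wC j) * g X Y) := by
    rw [expectedMinFormula, Finset.mul_sum]
    refine Finset.sum_congr rfl fun X _ => ?_
    rw [Finset.mul_sum]
    refine Finset.sum_congr rfl fun Y _ => ?_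
    rw [← add_mul, Finset.sum_add_sum_compl]
    simp only [g]
    congr 3
    push_cast
    ring
  rw [h1, h2]
  simp only [Finset.sum_add_distrib]
  congr 1
  refine Finset.sum_congr rfl fun X _ => ?_
  rw [← sum_powerset_signedBinom (Finset.univ : Finset C) (Fintype.card R - 1 - X.card)
    (k - X.card), Finset.powerset_univ, Finset.sum_div]
  refine Finset.sum_congr rfl fun Y _ => ?_
  simp only [g, Finset.card_univ]
  have e : (Fintype.card R : ℤ) - 1 - X.card + Fintype.card C - Y.card =
      Fintype.card R + Fintype.card C - 1 - X.card - Y.card := by ring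
  rw [e]
  -- Here `Yᶜ` has weight zero and nothing cancels, but the lower index is negative because `k <
  -- |C|`.
  by_cases hY : Y = Finset.univ
  · rw [signedBinom_of_neg _ (by rw [hY, Finset.card_univ]; omega)]
    simp
  · have hpos : 0 < ∑ j ∈ Yᶜ, wC j := Finset.sum_pos (fun j _ => hwC j) (by
      rwa [Finset.nonempty_iff_ne_empty, Ne, Finset.compl_eq_empty_iff])
    rw [mul_comm (∑ i ∈ Xᶜ, wR i), ← div_div, mul_div_assoc', mul_div_assoc',
      mul_div_cancel_left₀ _ hpos.ne']

omit [Fintype R] [Fintype C] [DecidableEq R] [DecidableEq C] in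
theorem minK_zero (M : R → C → ℝ) : minK 0 M = 0 := by
  have : {c : ℝ | ∃ s : Finset (R × C), IsAssignment 0 s ∧ cost M s = c} = {0} := by
    ext c
    simp only [Set.mem_singleton_iff]
    constructor
    · rintro ⟨s, hs, rfl⟩
      simp [Finset.card_eq_zero.1 hs.2, cost]
    · rintro rfl
      exact ⟨∅, ⟨fun p hp => by simp at hp, rfl⟩, by simp [cost]⟩
  rw [minK, this, csInf_singleton]

end Formula

theorem integral_minK_matrixMeasure {R C : Type*} [Fintype R] [Fintype C] [DecidableEq R]
    [DecidableEq C] {wR : R → ℝ} {wC : C → ℝ} (hwR : ∀ i, 0 < wR i) (hwC : ∀ j, 0 < wC j) {k : ℕ}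
    (hR : k ≤ Fintype.card R) (hC : k ≤ Fintype.card C) :
    ∫ f, minK k (Function.curry f) ∂(matrixMeasure wR wC) = expectedMinFormula wR wC k := by
  -- The column set must vary, since the recursion deletes a column.
  induction k generalizing C with
  | zero =>
    simp only [minK_zero, integral_zero]
    refine (Finset.sum_eq_zero fun X _ => Finset.sum_eq_zero fun Y _ => ?_).symm
    rw [signedBinom_of_neg _ (by omega), zero_div]
  | succ k ih =>
    have : Nonempty C := Fintype.card_pos_iff.1 (by omega)
    have hpos : 0 < ∑ j, wC j := Finset.sum_pos (fun j _ => hwC j) Finset.univ_nonempty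
    refine mul_left_cancel₀ hpos.ne' ?_
    rw [integral_minK_succ hwR hwC hR hC, expectedMinFormula_succ wR hwC hC, sum_soleTime]
    congr 1
    refine Finset.sum_congr rfl fun j _ => ?_
    have hC' : k ≤ Fintype.card {c // c ≠ j} := by rw [card_ne]; omega
    rw [ih (wC := fun c : {c // c ≠ j} => wC c) (fun c => hwC c) (Nat.le_of_succ_le hR) hC']

end RandomAssignment

theorem mainTheorem3 {R C : Type*} [Fintype R] [Fintype C] [DecidableEq R] [DecidableEq C]
    (wR : R → ℝ) (wC : C → ℝ) (hwR : ∀ i, 0 < wR i) (hwC : ∀ j, 0 < wC j)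
    {Ω : Type*} [MeasurableSpace Ω] (μ : Measure Ω) [IsProbabilityMeasure μ]
    (M : R → C → Ω → ℝ)
    (hlaw : ∀ i j, HasLaw (M i j) (expMeasure (wR i * wC j)) μ)
    (hindep : iIndepFun (fun (p : R × C) => M p.1 p.2) μ)
    (k : ℕ) (hkR : k ≤ Fintype.card R) (hkC : k ≤ Fintype.card C) :
    Integrable (fun ω => RandomAssignment.minK k (fun i j => M i j ω)) μ ∧
    ∫ ω, RandomAssignment.minK k (fun i j => M i j ω) ∂μ =
      ∑ X : Finset R, ∑ Y : Finset C,
        (RandomAssignment.binom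
            ((Fintype.card R : ℤ) + Fintype.card C - 1 - X.card - Y.card)
            ((k : ℤ) - 1 - X.card - Y.card) : ℝ) *
          ((-1 : ℝ) ^ ((k : ℤ) - 1 - X.card - Y.card) /
            ((∑ i ∈ Xᶜ, wR i) * (∑ j ∈ Yᶜ, wC j))) := by
  have hlaw' := RandomAssignment.hasLaw_matrixMeasure (M := fun p : R × C => M p.1 p.2)
    (fun p => hlaw p.1 p.2) hindep
  have hmeas := RandomAssignment.measurable_minK hkR hkC
  have hint := RandomAssignment.integrable_minK_matrixMeasure hwR hwC hkR hkC
  constructor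
  · rw [← hlaw'.map_eq] at hint
    exact hint.comp_aemeasurable hlaw'.aemeasurable
  · refine (hlaw'.integral_comp hmeas.aestronglyMeasurable).trans ?_
    rw [RandomAssignment.integral_minK_matrixMeasure hwR hwC hkR hkC]
    refine Finset.sum_congr rfl fun X _ => Finset.sum_congr rfl fun Y _ => ?_
    rw [RandomAssignment.signedBinom]
    ring
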